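/- Let $n\in\mathbb N$ and let $\Gamma_{jk}:\mathbb R^n\to\mathbb R^n$ ($1\le j,k\le n$) and $P:\mathbb R^n\to\mathcal L(\mathbb R^n)$ be bounded and globally Lipschitz. For $x_0\in\mathbb R$ and $0<T\le L<\infty$ let $$K_{L,T}=\{(t,x): 0\le t\le T,\ x_0-L+t\le x\le x_0+L-t\}$$ be the compact trapezoid of height $T$ with base $K_0=[x_0-L,x_0+L]$. For $K=K_{L,T}$ and $K_t=\{x:(t,x)\in K\}$, let $\mathscr H(K)$ be the set of continuous $u:K\to\mathbb R^n$ whose weak derivatives $\partial_tu,\partial_xu$ exist in $L^1(\operatorname{int}K)$ and belong to $C([0,T];L^1(K_\cdot))$, i.e. their extensions by $0$ to $[0,T]\times K_0$ belong to $C([0,T];L^1(K_0))$. Consider the Cauchy problem $$\partial_t^2u-\partial_x^2u=F_u:=\sum_{j,k=1}^n\Gamma_{jk}(u)\,(\partial_tu_j\,\partial_tu_k-\partial_xu_j\,\partial_xu_k)+P(u)f,\qquad u(0,\cdot)=u_0,\quad \partial_tu(0,\cdot)=v_0. \tag{1}$$ A mild solution of (1) on $K$ is a continuous function $u:K\to\mathbb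 R^n$ having weak derivatives $\partial_tu,\partial_xu\in L^1_{\mathrm{loc}}(K)$ such that, for every $(t,x)\in K$, $F_u$ is integrable on the triangle with vertices $(t,x),(0,x-t),(0,x+t)$ and $$u(t,x)=\tfrac12\big(u_0(x+t)+u_0(x-t)\big)+\tfrac12\int_{x-t}^{x+t}v_0(y)\,dy+\tfrac12\int_0^t\int_{x-t+\tau}^{x+t-\tau}F_u(\tau,y)\,dy\,d\tau .$$ **Theorem.** Let $x_0\in\mathbb R$, $L>0$. Let $u_0\in L^\infty(K_0;\mathbb R^n)\cap\dot W^{1,1}(K_0;\mathbb R^n)$ (identified with its continuous representative on $K_0$; $u_0\in\dot W^{1,1}$ means that its weak derivative is integrable), $v_0\in L^1(K_0;\mathbb R^n)$ and $f\in L^1(K_{L,L};\mathbb R^n)$, with no smallness assumption. Then there exists $T_0\in(0,L]$ such that problem (1) has a mild solution on $K_{L,T_0}$ belonging to $\mathscr H(K_{L,T_0})$, and this solution is unique among all mild solutions on $K_{L,T_0}$ belonging to $\mathscr H(K_{L,T_0})$. -/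

import Mathlib

open MeasureTheory Set Filter Topology
open scoped ContDiff NNReal ENNReal

namespace ForcedWaveMap

/-- The target space `ℝⁿ`.  Only its topology, its measurable structure and the notions of
boundedness, Lipschitz continuity and integrability are used below, and these are the same for the
`ℓ¹`-norm, the sup-norm or any other norm on `ℝⁿ`. -/
abbrev Vec (n : ℕ) : Type := Fin n → ℝ

/-- A bounded and globally Lipschitz map. -/
def BoundedLipschitz {E F : Type*} [NormedAddCommGroup E] [NormedAddCommGroup F]
    (g : E → F) : Prop :=
  ∃ C : ℝ≥0, (∀ z, ‖g z‖ ≤ C) ∧ LipschitzWith C g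

/-! ### Trapezoids.  Points of `ℝ × ℝ` are written `(t, x)`: time first, then space. -/

/-- The compact trapezoid with base `[x₀ - L, x₀ + L]` (half-length `L`) and height `T`. -/
def compactTrapezoid (x₀ L T : ℝ) : Set (ℝ × ℝ) :=
  {p | p.1 ∈ Icc 0 T ∧ p.2 ∈ Icc (x₀ - L + p.1) (x₀ + L - p.1)}

/-- The time slice `K_t` of a subset `K` of space-time. -/
def timeSlice (K : Set (ℝ × ℝ)) (t : ℝ) : Set ℝ := {x | (t, x) ∈ K}

/-- The closed triangle with vertices `(t, x)`, `(0, x - t)` and `(0, x + t)`. -/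
def backwardTriangle (t x : ℝ) : Set (ℝ × ℝ) :=
  {q | q.1 ∈ Icc 0 t ∧ q.2 ∈ Icc (x - t + q.1) (x + t - q.1)}

/-! ### Initial data -/

/-- `u₀` is the continuous representative, on the closed interval `[a, b]`, of an element of
`L^∞ ∩ Ẇ^{1,1}` of the interval: it is continuous (hence bounded) on `[a, b]`, locally absolutely
continuous in `(a, b)`, and its almost everywhere defined derivative is integrable. -/
structure MemLinftyW11 {n : ℕ} (a b : ℝ) (u₀ : ℝ → Vec n) : Prop where
  continuousOn : ContinuousOn u₀ (Icc a b)
  locallyAC : ∀ c d : ℝ, uIcc c d ⊆ Ioo a b → AbsolutelyContinuousOnInterval u₀ c d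
  integrable_deriv : IntegrableOn (deriv u₀) (Ioo a b)

/-- `(u₀, v₀) ∈ L^{1,1}([a, b]; ℝⁿ) = (L^∞ ∩ Ẇ^{1,1}) × L¹`. -/
structure MemL11 {n : ℕ} (a b : ℝ) (u₀ v₀ : ℝ → Vec n) : Prop where
  position : MemLinftyW11 a b u₀
  velocity : IntegrableOn v₀ (Icc a b)

/-! ### Weak derivatives and the solution space -/

/-- `w` is the weak derivative of `u` in the constant direction `e` on the open set `Ω`. -/
def HasWeakDerivOn {n : ℕ} (Ω : Set (ℝ × ℝ)) (e : ℝ × ℝ) (u w : ℝ × ℝ → Vec n) : Prop :=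
  LocallyIntegrableOn u Ω ∧ LocallyIntegrableOn w Ω ∧
  ∀ φ : ℝ × ℝ → ℝ, ContDiff ℝ ∞ φ → HasCompactSupport φ → tsupport φ ⊆ Ω →
    ∫ p in Ω, fderiv ℝ φ p e • u p = - ∫ p in Ω, φ p • w p

/-- `w ∈ C([0, T]; L¹(K_·))`: the extension of `w|_K` by zero to `[0, T] × K₀` is a continuous
map of time into `L¹(K₀)`.  (As `[0, T]` is compact, such a map is bounded.) -/
def MemCL1 {n : ℕ} (K : Set (ℝ × ℝ)) (T : ℝ) (w : ℝ × ℝ → Vec n) : Prop :=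
  (∀ t ∈ Icc 0 T,
    MemLp (fun x => K.indicator w (t, x)) 1 (volume.restrict (timeSlice K 0))) ∧
  ∀ s ∈ Icc 0 T,
    Tendsto
      (fun t => eLpNorm (fun x => K.indicator w (t, x) - K.indicator w (s, x)) 1
        (volume.restrict (timeSlice K 0)))
      (𝓝[Icc 0 T] s) (𝓝 0)

/-- The space `𝓗(K)` for a trapezoid `K` of finite height `T`: continuous functions on `K` whose
weak derivatives `∂ₜu, ∂ₓu` exist in `L¹(int K)` and (have representatives that) belong to
`C([0, T]; L¹(K_·))`. -/
def MemH {n : ℕ} (K : Set (ℝ × ℝ)) (T : ℝ) (u : ℝ × ℝ → Vec n) : Prop :=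
  ContinuousOn u K ∧
  ∃ ut ux : ℝ × ℝ → Vec n,
    HasWeakDerivOn (interior K) (1, 0) u ut ∧ HasWeakDerivOn (interior K) (0, 1) u ux ∧
    IntegrableOn ut (interior K) ∧ IntegrableOn ux (interior K) ∧
    MemCL1 K T ut ∧ MemCL1 K T ux

/-! ### The equation -/

/-- The right-hand side
`∑_{j,k} Γ_{jk}(u) (∂ₜu_j ∂ₜu_k - ∂ₓu_j ∂ₓu_k) + P(u) f` of the forced wave map equation, for
given `u`, `ut = ∂ₜu`, `ux = ∂ₓu` and `f`. -/
def forcedRHS {n : ℕ} (Γ : Fin n → Fin n → Vec n → Vec n) (P : Vec n → Vec n →L[ℝ] Vec n)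
    (u ut ux f : ℝ × ℝ → Vec n) (p : ℝ × ℝ) : Vec n :=
  (∑ j, ∑ k, (ut p j * ut p k - ux p j * ux p k) • Γ j k (u p)) + P (u p) (f p)

/-- `u` is an `ℝⁿ`-valued mild solution on the trapezoid `K` of
`∂ₜ²u - ∂ₓ²u = ∑_{j,k} Γ_{jk}(u) (∂ₜu_j ∂ₜu_k - ∂ₓu_j ∂ₓu_k) + P(u) f`,
`u(0, ·) = u₀`, `∂ₜu(0, ·) = v₀`:  it is continuous on `K`, has weak derivatives in `L¹_loc(K)`,
and the integral equation holds at every point of `K`, the right-hand side being integrable on the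
triangle over which it is integrated.  (Weak derivatives are unique up to null sets, so that the
choice of `ut`, `ux` is immaterial.) -/
def IsMildSolution {n : ℕ} (Γ : Fin n → Fin n → Vec n → Vec n)
    (P : Vec n → Vec n →L[ℝ] Vec n) (K : Set (ℝ × ℝ)) (u₀ v₀ : ℝ → Vec n)
    (f u : ℝ × ℝ → Vec n) : Prop :=
  ContinuousOn u K ∧
  ∃ ut ux : ℝ × ℝ → Vec n,
    HasWeakDerivOn (interior K) (1, 0) u ut ∧ HasWeakDerivOn (interior K) (0, 1) u ux ∧
    LocallyIntegrableOn ut K ∧ LocallyIntegrableOn ux K ∧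
    ∀ t x : ℝ, (t, x) ∈ K →
      IntegrableOn (forcedRHS Γ P u ut ux f) (backwardTriangle t x) ∧
      u (t, x) = (1 / 2 : ℝ) • (u₀ (x + t) + u₀ (x - t))
        + (1 / 2 : ℝ) • (∫ y in (x - t)..(x + t), v₀ y)
        + (1 / 2 : ℝ) • (∫ τ in (0 : ℝ)..t, ∫ y in (x - t + τ)..(x + t - τ),
            forcedRHS Γ P u ut ux f (τ, y))

end ForcedWaveMap

namespace ForcedWaveMap

/-! ### Integration over triangles and by parts. -/

section Calculus

variable {E : Type*} [NormedAddCommGroup E] [NormedSpace ℝ E]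

/-! The fixed-point problem is posed for the source `F`, an `L¹` function on the plane, rather than
for `u`. Given `F`, d'Alembert's formula (`wave`) yields `u`, and p = ∂ₜu + ∂ₓu, q = ∂ₜu - ∂ₓu come
from transport along characteristics (`wave_char`, `hasWeakDerivOn_wave`): p is initial data plus
the integral of `F` along a line x + t = const, and q the same along x - t = const. Hence |p| ≤ A(x
+ t) and |q| ≤ B(x - t) with A, B integrable on ℝ (`enorm_charDeriv_le`, `lintegral_majorant`).

The quadratic part of the equation is a null form: it contains only the products of a component of p
with a component of q (`forcedRHS_eq_nullRHS`). The product A(x + t) B(x - t) is integrable on the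
plane, since on a line x + t = y the factor A is constant while B is swept transversally
(`lintegral_strip_mul_le`). So the map `picard`, which sends `F` to the right-hand side computed
from its wave, preserves `L¹`.

Short times replace small data. The estimates involve the data through the supremum over y of the
integral of B(y - 2t) over a time interval, and this tends to 0 with the length of the interval by
absolute continuity of the integral, however large the norm of B is (`exists_lintegral_char_le`).
For a short time `picard` is therefore a contraction on a small ball of `L¹`
(`exists_picard_fixedPoint`). Its fixed point gives the solution, and the time continuity of the
derivatives is read off from the transport formula (`memCL1_charDeriv`).

For uniqueness, a mild solution restricted to the backward triangle of a point is the wave of some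
fixed point of `picard` on that triangle (`IsMildSolution.exists_fixedPoint`). Two fixed points of
any size coincide, by advancing in time with a step fixed in advance by absolute continuity
(`picard_fixedPoint_unique`). -/

lemma measurePreserving_shear (σ : ℝ) :
    MeasurePreserving (fun p : ℝ × ℝ => (p.1, p.2 + σ * p.1)) volume volume :=
  (MeasurePreserving.id (volume : Measure ℝ)).skew_product (g := fun t x => x + σ * t)
    (by fun_prop) (ae_of_all _ fun t => (measurePreserving_add_right volume (σ * t)).map_eq)

/-- Exchange of the order of integration over a triangle. -/
lemma integral_triangle_swap {H : ℝ → ℝ → E} {a b : ℝ} (hab : a ≤ b)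
    (h : IntegrableOn H.uncurry (Ioc a b ×ˢ Ioc a b)) :
    ∫ s in a..b, ∫ r in a..s, H s r = ∫ r in a..b, ∫ s in r..b, H s r := by
  -- Cutting off to `r ≤ s` turns the triangle into a square, where Fubini applies directly.
  set G : ℝ → ℝ → E := fun s r => {p : ℝ × ℝ | p.2 ≤ p.1}.indicator H.uncurry (s, r) with hG
  have hmeas : MeasurableSet {p : ℝ × ℝ | p.2 ≤ p.1} :=
    measurableSet_le measurable_snd measurable_fst
  have hGi : IntegrableOn G.uncurry (uIoc a b ×ˢ uIoc a b) := by
    rw [uIoc_of_le hab]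
    exact h.indicator hmeas
  have key := intervalIntegral_intervalIntegral_swap hGi
  have h1 : ∫ s in a..b, ∫ r in a..b, G s r = ∫ s in a..b, ∫ r in a..s, H s r := by
    refine intervalIntegral.integral_congr fun s hs => ?_
    rw [uIcc_of_le hab] at hs
    exact intervalIntegral.integral_indicator (f := H s) hs
  have h2 : ∫ r in a..b, ∫ s in a..b, G s r = ∫ r in a..b, ∫ s in r..b, H s r := by
    refine intervalIntegral.integral_congr fun r hr => ?_
    rw [uIcc_of_le hab] at hr
    rw [intervalIntegral.integral_of_le hab, intervalIntegral.integral_of_le hr.2]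
    have : (fun s => G s r) = (Ici r).indicator (fun s => H s r) := by
      ext s; simp [hG, indicator, Function.uncurry]
    rw [this, setIntegral_indicator measurableSet_Ici]
    refine setIntegral_congr_set ?_
    have hI : Ioc a b ∩ Ioi r = Ioc r b := by rw [Ioc_inter_Ioi, sup_eq_right.2 hr.1]
    exact hI ▸ (ae_eq_refl _).inter Ioi_ae_eq_Ici.symm
  rw [← h1, key, h2]

/-- Integration by parts for a primitive of an integrable vector-valued function. -/
lemma integral_deriv_smul_primitive [CompleteSpace E] {ψ ψ' : ℝ → ℝ} {g W : ℝ → E} {c : E} {R : ℝ}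
    (hR : 0 ≤ R) (hψ : ∀ s, HasDerivAt ψ (ψ' s) s) (hψ' : Continuous ψ')
    (h0 : ψ 0 = 0) (hψR : ψ R = 0) (hg : IntegrableOn g (Ioc 0 R))
    (hW : ∀ s ∈ Icc 0 R, W s = c + ∫ r in (0 : ℝ)..s, g r) :
    ∫ s in (0 : ℝ)..R, ψ' s • W s = - ∫ s in (0 : ℝ)..R, ψ s • g s := by
  have hgi : IntervalIntegrable g volume 0 R := by
    rwa [intervalIntegrable_iff_integrableOn_Ioc_of_le hR]
  have hftc : ∀ r s : ℝ, ∫ x in r..s, ψ' x = ψ s - ψ r := fun r s =>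
    intervalIntegral.integral_eq_sub_of_hasDerivAt (fun x _ => hψ x) (hψ'.intervalIntegrable _ _)
  have hprim : ContinuousOn (fun s => ∫ r in (0 : ℝ)..s, g r) (uIcc 0 R) :=
    intervalIntegral.continuousOn_primitive_interval (by
      rw [uIcc_of_le hR, integrableOn_Icc_iff_integrableOn_Ioc]; exact hg)
  have e1 : ∫ s in (0 : ℝ)..R, ψ' s • W s
      = (∫ s in (0 : ℝ)..R, ψ' s • c) + ∫ s in (0 : ℝ)..R, ∫ r in (0 : ℝ)..s, ψ' s • g r := by
    rw [← intervalIntegral.integral_add]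
    · refine intervalIntegral.integral_congr fun s hs => ?_
      rw [uIcc_of_le hR] at hs
      simp only [hW s hs, smul_add, intervalIntegral.integral_smul]
    · exact (hψ'.smul continuous_const).intervalIntegrable _ _
    · simp only [intervalIntegral.integral_smul]
      exact (hψ'.continuousOn.smul hprim).intervalIntegrable
  have hint : IntegrableOn (fun s r => ψ' s • g r : ℝ → ℝ → E).uncurry (Ioc 0 R ×ˢ Ioc 0 R) := by
    rw [IntegrableOn, Measure.volume_eq_prod, ← Measure.prod_restrict]
    exact Integrable.smul_prod (f := ψ') (g := g)
      ((hψ'.intervalIntegrable 0 R).1) hg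
  rw [e1, integral_triangle_swap hR hint, intervalIntegral.integral_smul_const, hftc, h0, hψR]
  simp only [sub_zero, zero_smul, zero_add]
  rw [← intervalIntegral.integral_neg]
  refine intervalIntegral.integral_congr fun r _ => ?_
  simp only [intervalIntegral.integral_smul_const, hftc, hψR]
  simp

end Calculus

/-! ### From primitives along parallel lines to weak derivatives. -/

section WeakDeriv

variable {n : ℕ}

/-- A function whose restrictions to the lines of direction `(1, σ)` are primitives of `p` has
weak derivative `p` in that direction. -/
lemma hasWeakDerivOn_of_primitive {σ : ℝ} {u p : ℝ × ℝ → Vec n} {Ω : Set (ℝ × ℝ)}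
    (hΩo : IsOpen Ω) (hΩ : ∀ z ∈ Ω, 0 < z.1) (hu : ContinuousOn u {z | 0 ≤ z.1})
    (hp : ∀ T : ℝ, IntegrableOn p (Icc 0 T ×ˢ univ))
    (h : ∀ y s : ℝ, 0 ≤ s → u (s, y + σ * s) = u (0, y) + ∫ r in (0 : ℝ)..s, p (r, y + σ * r)) :
    HasWeakDerivOn Ω (1, σ) u p := by
  refine ⟨?_, ?_, ?_⟩
  · exact (hu.mono fun z hz => (hΩ z hz).le).locallyIntegrableOn hΩo.measurableSet
  · intro z hz
    refine ⟨Icc 0 (z.1 + 1) ×ˢ univ, ?_, hp _⟩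
    refine mem_nhdsWithin_of_mem_nhds ?_
    exact prod_mem_nhds (Icc_mem_nhds (hΩ z hz) (by linarith)) univ_mem
  · intro φ hφ hφc hφΩ
    set S := tsupport φ with hS
    set φ' : ℝ × ℝ → ℝ := fun z => fderiv ℝ φ z (1, σ) with hφ'
    have hφ'c : Continuous φ' := (hφ.continuous_fderiv (by simp)).clm_apply continuous_const
    have hz : ∀ z, z ∉ S → φ z = 0 := fun z hz => image_eq_zero_of_notMem_tsupport hz
    have hz' : ∀ z, z ∉ S → φ' z = 0 := fun z hz => by
      have : fderiv ℝ φ z = 0 := by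
        by_contra hne
        exact hz (support_fderiv_subset ℝ hne)
      simp [hφ', this]
    have hSc : IsCompact S := hφc
    obtain ⟨R, hR⟩ := (hSc.image continuous_fst).bddAbove
    -- Strictly beyond the support, so that the test function vanishes at time `R'`; it vanishes at
    -- time 0 because `Ω` lies in positive times.
    set R' := max R 0 + 1
    have hR' : 0 ≤ R' := by positivity
    have hSR : ∀ z ∈ S, 0 < z.1 ∧ z.1 < R' := fun z hzS =>
      ⟨hΩ z (hφΩ hzS), by
        have : z.1 ≤ R := hR ⟨z, hzS, rfl⟩
        have : R ≤ max R 0 := le_max_left _ _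
        simp only [R']; linarith⟩
    have hl : Integrable (fun z => φ' z • u z) := by
      have : IntegrableOn (fun z => φ' z • u z) S :=
        (hφ'c.continuousOn.smul (hu.mono fun z hzS => (hSR z hzS).1.le)).integrableOn_compact hSc
      rwa [integrableOn_iff_integrable_of_support_subset] at this
      intro z hzs
      by_contra hzS
      exact hzs (by simp [hz' z hzS])
    have hr : Integrable (fun z => φ z • p z) := by
      have hb : ∃ C, ∀ z, ‖φ z‖ ≤ C := hφc.exists_bound_of_continuous hφ.continuous
      obtain ⟨C, hC⟩ := hb
      have : IntegrableOn (fun z => φ z • p z) (Icc 0 R' ×ˢ univ) :=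
        (hp R').bdd_smul C hφ.continuous.aestronglyMeasurable (ae_of_all _ hC)
      rwa [integrableOn_iff_integrable_of_support_subset] at this
      intro z hzs
      by_contra hzS
      refine hzs ?_
      by_cases hzS' : z ∈ S
      · exact absurd ⟨⟨(hSR z hzS').1.le, (hSR z hzS').2.le⟩, mem_univ _⟩ hzS
      · simp [hz z hzS']
    rw [setIntegral_eq_integral_of_forall_compl_eq_zero (f := fun z => φ' z • u z),
      setIntegral_eq_integral_of_forall_compl_eq_zero (f := fun z => φ z • p z)]
    rotate_left
    · intro z hzΩ; simp [hz z fun hc => hzΩ (hφΩ hc)]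
    · intro z hzΩ; simp [hz' z fun hc => hzΩ (hφΩ hc)]
    have mp := measurePreserving_shear σ
    have me : MeasurableEmbedding (fun p : ℝ × ℝ => (p.1, p.2 + σ * p.1)) := by
      let e : ℝ × ℝ ≃ᵐ ℝ × ℝ :=
        { toFun := fun p => (p.1, p.2 + σ * p.1)
          invFun := fun p => (p.1, p.2 - σ * p.1)
          left_inv := fun p => by simp
          right_inv := fun p => by simp
          measurable_toFun := by simp only [Equiv.coe_fn_mk]; fun_prop
          measurable_invFun := by simp only [Equiv.symm_mk, Equiv.coe_fn_mk]; fun_prop }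
      exact e.measurableEmbedding
    -- The shear straightens the lines of direction `(1, σ)` into coordinate lines; Fubini then
    -- reduces the claim to integration by parts on almost every line.
    rw [← mp.integral_comp me fun z => φ' z • u z, ← mp.integral_comp me fun z => φ z • p z]
    have hl' := (mp.integrable_comp_of_integrable hl)
    have hr' := (mp.integrable_comp_of_integrable hr)
    rw [Measure.volume_eq_prod] at hl' hr' ⊢
    refine (integral_prod_symm _ hl').trans
      (Eq.trans ?_ (congrArg Neg.neg (integral_prod_symm _ hr')).symm)
    rw [← integral_neg]
    have hpi : Integrable (fun z : ℝ × ℝ => (Icc 0 R' ×ˢ univ).indicator p (z.1, z.2 + σ * z.1))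
        (volume.prod volume) :=
      mp.integrable_comp_of_integrable
        ((integrable_indicator_iff (measurableSet_Icc.prod .univ)).2 (hp R'))
    refine integral_congr_ae ?_
    filter_upwards [hpi.prod_left_ae] with y hy
    have hy' : IntegrableOn (fun s => p (s, y + σ * s)) (Ioc 0 R') := by
      have : Integrable ((Icc 0 R').indicator fun s => p (s, y + σ * s)) := by
        refine hy.congr (ae_of_all _ fun s => ?_)
        simp [indicator]
      rw [integrable_indicator_iff measurableSet_Icc] at this
      exact this.mono_set Ioc_subset_Icc_self
    have hd : ∀ s : ℝ, HasDerivAt (fun s => φ (s, y + σ * s)) (φ' (s, y + σ * s)) s := by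
      intro s
      have h1 : HasDerivAt (fun s : ℝ => (s, y + σ * s)) (1, σ) s := by
        refine (hasDerivAt_id s).prodMk ?_
        simpa using ((hasDerivAt_id s).const_mul σ).const_add y
      exact ((hφ.differentiable (by simp)).differentiableAt.hasFDerivAt (x := (s, y + σ * s))).comp_hasDerivAt s h1
    have conv : ∀ H : ℝ → Vec n, (∀ s, H s ≠ 0 → (s, y + σ * s) ∈ S) →
        ∫ s, H s = ∫ s in (0 : ℝ)..R', H s := by
      intro H hH
      rw [intervalIntegral.integral_of_le hR']
      refine (setIntegral_eq_integral_of_forall_compl_eq_zero fun s hs => ?_).symm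
      by_contra hne
      have := hSR _ (hH s hne)
      exact hs ⟨this.1, this.2.le⟩
    rw [conv _ (fun s hs => by by_contra hc; exact hs (by simp [hz' _ hc])),
      conv _ (fun s hs => by by_contra hc; exact hs (by simp [hz _ hc]))]
    refine integral_deriv_smul_primitive (ψ := fun s => φ (s, y + σ * s))
      (g := fun s => p (s, y + σ * s)) (W := fun s => u (s, y + σ * s)) (c := u (0, y)) hR' hd ?_ ?_ ?_ hy' ?_
    · exact hφ'c.comp (by fun_prop)
    · exact hz _ fun hc => (hSR _ hc).1.ne rfl
    · exact hz _ fun hc => (hSR _ hc).2.ne rfl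
    · intro s hs; exact h y s hs.1

end WeakDeriv

/-! ### Characteristic coordinates on the plane. -/

section CharCoordinates

variable {E : Type*} [NormedAddCommGroup E]

lemma lintegral_comp_mul_add {c : ℝ} (hc : c ≠ 0) (d : ℝ) {h : ℝ → ℝ≥0∞} (hh : Measurable h) :
    ∫⁻ r, h (c * r + d) = ENNReal.ofReal |c⁻¹| * ∫⁻ r, h r := by
  have h1 : ∫⁻ r, h (c * r + d) = ∫⁻ r, h (r + d) ∂(Measure.map (c * ·) volume) :=
    (lintegral_map (f := fun r => h (r + d)) (g := (c * ·)) (by fun_prop) (by fun_prop)).symm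
  rw [h1, Real.map_volume_mul_left hc, lintegral_smul_measure, lintegral_add_right_eq_self]
  rfl

lemma integrable_comp_mul_snd {c : ℝ} (hc : c ≠ 0) {F : ℝ × ℝ → E} (hFm : StronglyMeasurable F)
    (hF : Integrable F) : Integrable fun z : ℝ × ℝ => F (z.1, c * z.2) := by
  have hm : StronglyMeasurable fun z : ℝ × ℝ => F (z.1, c * z.2) :=
    hFm.comp_measurable (by fun_prop)
  refine ⟨hm.aestronglyMeasurable, ?_⟩
  have h2 := hF.2
  rw [hasFiniteIntegral_iff_enorm, Measure.volume_eq_prod, lintegral_prod _ hFm.enorm.aemeasurable]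
    at h2
  rw [hasFiniteIntegral_iff_enorm, Measure.volume_eq_prod, lintegral_prod _ hm.enorm.aemeasurable]
  have : ∀ τ, ∫⁻ r, ‖F (τ, c * r)‖ₑ = ENNReal.ofReal |c⁻¹| * ∫⁻ r, ‖F (τ, r)‖ₑ := fun τ => by
    simpa using lintegral_comp_mul_add hc 0 (h := fun r => ‖F (τ, r)‖ₑ)
      (hFm.enorm.comp (by fun_prop))
  simp only [this]
  rw [lintegral_const_mul _ (hFm.enorm.lintegral_prod_right' )]
  exact ENNReal.mul_lt_top ENNReal.ofReal_lt_top h2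

lemma measurePreserving_shear_add (σ y : ℝ) :
    MeasurePreserving (fun p : ℝ × ℝ => (p.1, p.2 + (y - σ * p.1))) volume volume :=
  (MeasurePreserving.id (volume : Measure ℝ)).skew_product (g := fun t x => x + (y - σ * t))
    (by fun_prop) (ae_of_all _ fun t => (measurePreserving_add_right volume (y - σ * t)).map_eq)

/-- For fixed `y` this is an affine change of variables of the plane with Jacobian of modulus
`2|σ|`: the first coordinate picks a point of a line of direction `(1, σ)`, the second moves along
the transversal characteristic through it. Integrability thus holds for every `y`, not only almost
every one, so that `duhamel_char` is an identity on every line. -/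
lemma integrable_char {σ : ℝ} (hσ : σ ≠ 0) {F : ℝ × ℝ → E} (hFm : StronglyMeasurable F)
    (hF : Integrable F) (y : ℝ) :
    Integrable fun z : ℝ × ℝ => F (z.2, y + σ * z.1 + σ * z.1 - σ * z.2) := by
  have h1 : Integrable fun z : ℝ × ℝ => F (z.1, z.2 + (y - σ * z.1)) :=
    (measurePreserving_shear_add σ y).integrable_comp_of_integrable hF
  have h2 := integrable_comp_mul_snd (c := 2 * σ) (by positivity)
    (hFm.comp_measurable (g := fun z : ℝ × ℝ => (z.1, z.2 + (y - σ * z.1))) (by fun_prop)) h1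
  have h3 := h2.swap
  refine h3.congr (ae_of_all _ fun z => ?_)
  simp only [Function.comp, Prod.swap]
  congr 2; ring

end CharCoordinates

/-! ### D'Alembert's formula for an integrable source. -/

section Wave

variable {E : Type*} [NormedAddCommGroup E] [NormedSpace ℝ E]

/-- The integral of `F` along the backward characteristic of slope `-σ` through `z`. -/
noncomputable def charIntegral (σ : ℝ) (F : ℝ × ℝ → E) (z : ℝ × ℝ) : E :=
  ∫ τ in Ioc 0 z.1, F (τ, z.2 + σ * z.1 - σ * τ)

/-- The derivative in direction `(1, σ)` of the solution of the inhomogeneous wave equation. -/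
noncomputable def charDeriv (σ : ℝ) (P : ℝ → E) (F : ℝ × ℝ → E) (z : ℝ × ℝ) : E :=
  P (z.2 + σ * z.1) + charIntegral σ F z

/-- The inhomogeneous part of d'Alembert's formula. -/
noncomputable def duhamel (F : ℝ × ℝ → E) (z : ℝ × ℝ) : E :=
  (1 / 2 : ℝ) • ∫ τ in (0 : ℝ)..z.1, ∫ y in (z.2 - z.1 + τ)..(z.2 + z.1 - τ), F (τ, y)

/-- The homogeneous part of d'Alembert's formula. -/
noncomputable def freeWave (U v : ℝ → E) (z : ℝ × ℝ) : E :=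
  (1 / 2 : ℝ) • (U (z.2 + z.1) + U (z.2 - z.1))
    + (1 / 2 : ℝ) • ∫ y in (z.2 - z.1)..(z.2 + z.1), v y

/-- D'Alembert's formula. -/
noncomputable def wave (U v : ℝ → E) (F : ℝ × ℝ → E) (z : ℝ × ℝ) : E :=
  freeWave U v z + duhamel F z

lemma isClosed_backwardTriangle (t x : ℝ) : IsClosed (backwardTriangle t x) := by
  have : backwardTriangle t x = {q | 0 ≤ q.1} ∩ {q | q.1 ≤ t} ∩ {q | x - t + q.1 ≤ q.2}
      ∩ {q | q.2 ≤ x + t - q.1} := by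
    ext q; simp [backwardTriangle, mem_Icc, and_assoc]
  rw [this]
  refine (((isClosed_le ?_ ?_).inter (isClosed_le ?_ ?_)).inter (isClosed_le ?_ ?_)).inter
    (isClosed_le ?_ ?_) <;> fun_prop

/-- As an area integral, the Duhamel term ignores changes of `F` on null sets and can be treated by
dominated convergence. -/
lemma duhamel_eq_setIntegral {F : ℝ × ℝ → E} {z : ℝ × ℝ} (hz : 0 ≤ z.1)
    (hF : IntegrableOn F (backwardTriangle z.1 z.2)) :
    duhamel F z = (1 / 2 : ℝ) • ∫ q in backwardTriangle z.1 z.2, F q := by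
  have hm := (isClosed_backwardTriangle z.1 z.2).measurableSet
  have hi := (integrable_indicator_iff hm).2 hF
  rw [duhamel, ← integral_indicator hm]
  congr 1
  rw [Measure.volume_eq_prod] at hi ⊢
  rw [integral_prod _ hi, intervalIntegral.integral_of_le hz, ← integral_Icc_eq_integral_Ioc,
    ← integral_indicator measurableSet_Icc]
  congr 1
  ext τ
  by_cases hτ : τ ∈ Icc 0 z.1
  · rw [indicator_of_mem hτ, intervalIntegral.integral_of_le (by linarith [hτ.2]),
      ← integral_Icc_eq_integral_Ioc, ← integral_indicator measurableSet_Icc]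
    congr 1
    ext y
    by_cases hy : y ∈ Icc (z.2 - z.1 + τ) (z.2 + z.1 - τ)
    · rw [indicator_of_mem hy, indicator_of_mem]; exact ⟨hτ, hy⟩
    · rw [indicator_of_notMem hy, indicator_of_notMem]; exact fun h => hy h.2
  · rw [indicator_of_notMem hτ]
    symm
    convert integral_zero ℝ E with y
    rw [indicator_of_notMem]; exact fun h => hτ h.1

lemma duhamel_congr {F G : ℝ × ℝ → E} {z : ℝ × ℝ} (hz : 0 ≤ z.1)
    (hF : IntegrableOn F (backwardTriangle z.1 z.2))
    (hFG : F =ᵐ[volume.restrict (backwardTriangle z.1 z.2)] G) : duhamel F z = duhamel G z := by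
  rw [duhamel_eq_setIntegral hz hF, duhamel_eq_setIntegral hz (hF.congr hFG), integral_congr_ae hFG]

lemma enorm_duhamel_sub_le {F G : ℝ × ℝ → E} {z : ℝ × ℝ} (hz : 0 ≤ z.1) (hF : Integrable F)
    (hG : Integrable G) :
    ‖duhamel F z - duhamel G z‖ₑ ≤ ∫⁻ q in Ioc 0 z.1 ×ˢ univ, ‖F q - G q‖ₑ := by
  rw [duhamel_eq_setIntegral hz hF.integrableOn, duhamel_eq_setIntegral hz hG.integrableOn,
    ← smul_sub, ← integral_sub hF.integrableOn hG.integrableOn]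
  have h1 : ∫⁻ q in backwardTriangle z.1 z.2, ‖F q - G q‖ₑ
      ≤ ∫⁻ q in Icc 0 z.1 ×ˢ univ, ‖F q - G q‖ₑ :=
    lintegral_mono_set fun q hq => ⟨hq.1, mem_univ _⟩
  have h2 : ∫⁻ q in Icc 0 z.1 ×ˢ univ, ‖F q - G q‖ₑ
      = ∫⁻ q in Ioc 0 z.1 ×ˢ univ, ‖F q - G q‖ₑ := by
    rw [Measure.volume_eq_prod]
    exact setLIntegral_congr (Measure.set_prod_ae_eq Ioc_ae_eq_Icc.symm (ae_eq_refl _))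
  calc _ ≤ ‖(1 / 2 : ℝ)‖ₑ * ‖∫ q in backwardTriangle z.1 z.2, (F q - G q)‖ₑ := (enorm_smul _ _).le
    _ ≤ 1 * ∫⁻ q in backwardTriangle z.1 z.2, ‖F q - G q‖ₑ := by
        gcongr
        · rw [← enorm_one (G := ℝ)]
          exact enorm_le_iff_norm_le.2 (by norm_num)
        · exact enorm_integral_le_lintegral_enorm _
    _ ≤ _ := by rw [one_mul]; exact h1.trans h2.le

lemma continuousOn_duhamel {F : ℝ × ℝ → E} (hF : Integrable F) :
    ContinuousOn (duhamel F) {z | 0 ≤ z.1} := by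
  have key : Continuous fun z : ℝ × ℝ => ∫ q, (backwardTriangle z.1 z.2).indicator F q := by
    refine continuous_iff_continuousAt.2 fun z₀ => ?_
    refine continuousAt_of_dominated (bound := fun q => ‖F q‖) ?_ ?_ hF.norm ?_
    · exact Eventually.of_forall fun z =>
        hF.1.indicator (isClosed_backwardTriangle _ _).measurableSet
    · exact Eventually.of_forall fun z => ae_of_all _ fun q => norm_indicator_le_norm_self _ _
    -- Away from the slanted sides of the triangle at `z₀`, the indicator is locally constant in
    -- `z`; the base does not move with `z`.
    · have hnull : ∀ᵐ q : ℝ × ℝ, |q.2 - z₀.2| ≠ z₀.1 - q.1 := by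
        rw [Measure.volume_eq_prod]
        have hms : MeasurableSet {q : ℝ × ℝ | |q.2 - z₀.2| ≠ z₀.1 - q.1} :=
          (isClosed_eq (by fun_prop) (by fun_prop)).measurableSet.compl
        refine (Measure.ae_prod_iff_ae_ae hms).2 (ae_of_all _ fun τ => ?_)
        have : ∀ᵐ y : ℝ, y ∉ ({z₀.2 + (z₀.1 - τ), z₀.2 - (z₀.1 - τ)} : Set ℝ) :=
          compl_mem_ae_iff.2 ((Set.toFinite _).measure_zero volume)
        filter_upwards [this] with y hy he
        refine hy ?_
        simp only [mem_insert_iff, mem_singleton_iff]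
        rcases abs_cases (y - z₀.2) with h | h
        · left; linarith [h.1]
        · right; linarith [h.1]
      filter_upwards [hnull] with q hq
      have hmem : ∀ z : ℝ × ℝ, q ∈ backwardTriangle z.1 z.2 ↔
          0 ≤ q.1 ∧ |q.2 - z.2| ≤ z.1 - q.1 := by
        intro z
        simp only [backwardTriangle, mem_ofPred_eq, mem_Icc, abs_le]
        constructor
        · rintro ⟨⟨h1, h2⟩, h3, h4⟩; exact ⟨h1, by linarith, by linarith⟩
        · rintro ⟨h1, h2, h3⟩; exact ⟨⟨h1, by linarith⟩, by linarith, by linarith⟩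
      have hev : ∀ᶠ z in 𝓝 z₀, (backwardTriangle z.1 z.2).indicator F q
          = (backwardTriangle z₀.1 z₀.2).indicator F q := by
        have c1 : Continuous fun z : ℝ × ℝ => |q.2 - z.2| := by fun_prop
        have c2 : Continuous fun z : ℝ × ℝ => z.1 - q.1 := by fun_prop
        rcases lt_or_gt_of_ne hq with h | h
        · filter_upwards [(isOpen_lt c1 c2).mem_nhds h] with z hz
          simp only [indicator, hmem, h.le, (show |q.2 - z.2| ≤ z.1 - q.1 from le_of_lt hz)]
        · filter_upwards [(isOpen_lt c2 c1).mem_nhds h] with z hz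
          simp only [indicator, hmem, not_le.2 h,
            (show ¬ |q.2 - z.2| ≤ z.1 - q.1 from not_le.2 hz)]
      exact tendsto_const_nhds.congr' (hev.mono fun z hz => hz.symm)
  refine (key.const_smul (1 / 2 : ℝ)).continuousOn.congr fun z hz => ?_
  change duhamel F z = (1 / 2 : ℝ) • ∫ q, (backwardTriangle z.1 z.2).indicator F q
  rw [duhamel_eq_setIntegral hz hF.integrableOn,
    integral_indicator (isClosed_backwardTriangle _ _).measurableSet]

lemma continuousOn_wave {U v : ℝ → E} {F : ℝ × ℝ → E} (hU : Continuous U) (hv : Integrable v)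
    (hF : Integrable F) : ContinuousOn (wave U v F) {z | 0 ≤ z.1} := by
  refine ContinuousOn.add (Continuous.continuousOn ?_) (continuousOn_duhamel hF)
  have hprim : Continuous fun x : ℝ => ∫ y in (0 : ℝ)..x, v y :=
    intervalIntegral.continuous_primitive (fun a b => hv.intervalIntegrable) 0
  have : freeWave U v = fun z => (1 / 2 : ℝ) • (U (z.2 + z.1) + U (z.2 - z.1))
      + (1 / 2 : ℝ) • ((∫ y in (0 : ℝ)..(z.2 + z.1), v y) - ∫ y in (0 : ℝ)..(z.2 - z.1), v y) := by
    ext z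
    rw [freeWave, intervalIntegral.integral_interval_sub_left] <;> exact hv.intervalIntegrable
  rw [this]
  fun_prop


/-- Exchange the two integrations on the right. At a fixed time `τ`, the argument `y + 2σr - στ`
sweeps the slice of the backward triangle as `r` runs from `τ` to `s`, and its speed 2 accounts for
the factor 1/2 in d'Alembert's formula. -/
lemma duhamel_char {σ : ℝ} (hσ : σ = 1 ∨ σ = -1) {F : ℝ × ℝ → E} (hFm : StronglyMeasurable F)
    (hF : Integrable F) {s : ℝ} (hs : 0 ≤ s) (y : ℝ) :
    duhamel F (s, y + σ * s) = ∫ r in (0 : ℝ)..s, charIntegral σ F (r, y + σ * r) := by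
  have hσ0 : σ ≠ 0 := by rcases hσ with rfl | rfl <;> norm_num
  have hi := integrable_char hσ0 hFm hF y
  have e1 : ∫ r in (0 : ℝ)..s, charIntegral σ F (r, y + σ * r)
      = ∫ r in (0 : ℝ)..s, ∫ τ in (0 : ℝ)..r, F (τ, y + σ * r + σ * r - σ * τ) := by
    refine intervalIntegral.integral_congr fun r hr => ?_
    rw [uIcc_of_le hs] at hr
    simp only [charIntegral]
    rw [intervalIntegral.integral_of_le hr.1]
  rw [e1, integral_triangle_swap (H := fun r τ => F (τ, y + σ * r + σ * r - σ * τ)) hs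
    hi.integrableOn, duhamel, ← intervalIntegral.integral_smul]
  refine intervalIntegral.integral_congr fun τ _ => ?_
  have e2 : ∀ r, F (τ, y + σ * r + σ * r - σ * τ) = F (τ, (2 * σ) * r + (y - σ * τ)) := fun r => by
    congr 2; ring
  simp only [e2]
  rw [intervalIntegral.integral_comp_mul_add (fun x => F (τ, x)) (by positivity)]
  rcases hσ with rfl | rfl
  · rw [show (2 : ℝ) * 1 * τ + (y - 1 * τ) = y + 1 * s - s + τ by ring,
      show (2 : ℝ) * 1 * s + (y - 1 * τ) = y + 1 * s + s - τ by ring]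
    norm_num
  · rw [show (2 : ℝ) * -1 * τ + (y - -1 * τ) = y + -1 * s + s - τ by ring,
      show (2 : ℝ) * -1 * s + (y - -1 * τ) = y + -1 * s - s + τ by ring,
      intervalIntegral.integral_symm (y + -1 * s - s + τ)]
    norm_num

/-- Along a line of direction `(1, σ)` one of `x + t`, `x - t` stays equal to `y` and the other
moves at speed 2, so only one end of the d'Alembert interval contributes. With `g` the derivative of
`U`, `v + σ • g` is the initial value of `∂ₜu + σ ∂ₓu`. -/
lemma freeWave_char {σ : ℝ} (hσ : σ = 1 ∨ σ = -1) {U v g : ℝ → E} (hv : Integrable v)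
    (hg : Integrable g) (hU : ∀ x y, U x = U y + ∫ z in y..x, g z) (s y : ℝ) :
    freeWave U v (s, y + σ * s) = U y + ∫ r in (0 : ℝ)..s, (v + σ • g) (y + σ * r + σ * r) := by
  have e2 : ∀ r, (v + σ • g) (y + σ * r + σ * r) = (v + σ • g) ((2 * σ) * r + y) := fun r => by
    rw [show y + σ * r + σ * r = (2 * σ) * r + y by ring]
  simp only [e2, freeWave]
  rw [intervalIntegral.integral_comp_mul_add _ (by rcases hσ with rfl | rfl <;> norm_num)]
  have e3 : ∀ a b : ℝ, ∫ x in a..b, (v + σ • g) x = (∫ x in a..b, v x) + σ • ∫ x in a..b, g x := by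
    intro a b
    rw [← intervalIntegral.integral_smul, ← intervalIntegral.integral_add]
    · rfl
    · exact hv.intervalIntegrable
    · exact (hg.smul σ).intervalIntegrable
  rw [e3, hU (y + σ * s + s) y, hU (y + σ * s - s) y]
  rcases hσ with rfl | rfl
  · rw [show y + 1 * s + s = 2 * s + y by ring, show y + 1 * s - s = y by ring,
      show (2 : ℝ) * 1 * s + y = 2 * s + y by ring, show (2 : ℝ) * 1 * 0 + y = y by ring,
      show (2 * 1 : ℝ)⁻¹ = 1 / 2 by norm_num, intervalIntegral.integral_same]
    module
  · rw [show y + -1 * s + s = y by ring, show y + -1 * s - s = -(2 * s) + y by ring,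
      show (2 : ℝ) * -1 * s + y = -(2 * s) + y by ring, show (2 : ℝ) * -1 * 0 + y = y by ring,
      show (2 * -1 : ℝ)⁻¹ = -(1 / 2) by norm_num, intervalIntegral.integral_same,
      intervalIntegral.integral_symm (-(2 * s) + y) y,
      intervalIntegral.integral_symm (-(2 * s) + y) y]
    module

lemma wave_char {σ : ℝ} (hσ : σ = 1 ∨ σ = -1) {U v g : ℝ → E} {F : ℝ × ℝ → E}
    (hFm : StronglyMeasurable F) (hF : Integrable F) (hv : Integrable v)
    (hg : Integrable g) (hU : ∀ x y, U x = U y + ∫ z in y..x, g z) {s : ℝ} (hs : 0 ≤ s) (y : ℝ) :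
    wave U v F (s, y + σ * s) = wave U v F (0, y)
      + ∫ r in (0 : ℝ)..s, charDeriv σ (v + σ • g) F (r, y + σ * r) := by
  have hσ0 : σ ≠ 0 := by rcases hσ with rfl | rfl <;> norm_num
  have h0 : wave U v F (0, y) = U y := by
    simp only [wave, freeWave, duhamel, add_zero, sub_zero, intervalIntegral.integral_same,
      smul_zero]
    module
  rw [h0, wave, freeWave_char hσ hv hg hU, duhamel_char hσ hFm hF hs, add_assoc,
    ← intervalIntegral.integral_add]
  · rfl
  · have : Integrable fun r => (v + σ • g) ((2 * σ) * r + y) :=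
      ((hv.add (hg.smul σ)).comp_add_right y).comp_mul_left' (by positivity)
    refine (this.congr (ae_of_all _ fun r => ?_)).intervalIntegrable
    dsimp only
    ring_nf
  -- `charIntegral` on this line is a marginal of the function in `integrable_char`, cut off to `0 <
  -- τ ≤ r`.
  · rw [intervalIntegrable_iff_integrableOn_Ioc_of_le hs]
    have hi := (integrable_char hσ0 hFm hF y).indicator (s := {z : ℝ × ℝ | z.2 ∈ Ioc 0 z.1})
      ((measurableSet_lt measurable_const measurable_snd).inter
        (measurableSet_le measurable_snd measurable_fst))
    have := Integrable.integral_prod_left hi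
    refine (this.congr (ae_of_all _ fun r => ?_)).integrableOn
    simp only [charIntegral]
    rw [← integral_indicator measurableSet_Ioc]
    rfl

end Wave

/-! ### Domination of the characteristic derivatives by functions of one variable. -/

section Majorant

variable {E : Type*} [NormedAddCommGroup E]

/-- A function which dominates `charDeriv σ P F` along each characteristic of slope `-σ`. -/
noncomputable def majorant (σ : ℝ) (P : ℝ → E) (F : ℝ × ℝ → E) (y : ℝ) : ℝ≥0∞ :=
  ‖P y‖ₑ + ∫⁻ τ, ‖F (τ, y - σ * τ)‖ₑ

/-- Tonelli and translation invariance at each time: the integrals along all characteristics of one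
family together exhaust the strip. -/
lemma lintegral_char {h : ℝ × ℝ → ℝ≥0∞} (hh : Measurable h) (σ : ℝ) {I : Set ℝ} :
    ∫⁻ y, ∫⁻ τ in I, h (τ, y - σ * τ) = ∫⁻ z in I ×ˢ univ, h z := by
  rw [lintegral_lintegral_swap (by unfold Function.uncurry; fun_prop), Measure.volume_eq_prod,
    ← Measure.prod_restrict, Measure.restrict_univ, lintegral_prod _ hh.aemeasurable]
  exact lintegral_congr fun τ => lintegral_sub_right_eq_self (fun y => h (τ, y)) (σ * τ)

lemma measurable_lintegral_char {h : ℝ × ℝ → ℝ≥0∞} (hh : Measurable h) (σ : ℝ) (I : Set ℝ) :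
    Measurable fun y => ∫⁻ τ in I, h (τ, y - σ * τ) :=
  Measurable.lintegral_prod_right' (f := fun z : ℝ × ℝ => h (z.2, z.1 - σ * z.2)) (by fun_prop)

lemma measurable_majorant {σ : ℝ} {P : ℝ → E} {F : ℝ × ℝ → E} (hP : StronglyMeasurable P)
    (hF : StronglyMeasurable F) : Measurable (majorant σ P F) := by
  have := measurable_lintegral_char hF.enorm σ univ
  rw [Measure.restrict_univ] at this
  exact hP.enorm.add this

lemma lintegral_majorant {σ : ℝ} {P : ℝ → E} {F : ℝ × ℝ → E} (hP : StronglyMeasurable P)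
    (hF : StronglyMeasurable F) :
    ∫⁻ y, majorant σ P F y = (∫⁻ y, ‖P y‖ₑ) + ∫⁻ z, ‖F z‖ₑ := by
  have := lintegral_char hF.enorm σ (I := univ)
  rw [Measure.restrict_univ, univ_prod_univ, Measure.restrict_univ] at this
  simp only [majorant]
  rw [lintegral_add_left hP.enorm, this]

lemma lintegral_majorant_ne_top {σ : ℝ} {P : ℝ → E} {F : ℝ × ℝ → E} (hP : StronglyMeasurable P)
    (hF : StronglyMeasurable F) (hPi : Integrable P) (hFi : Integrable F) :
    ∫⁻ y, majorant σ P F y ≠ ⊤ := by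
  rw [lintegral_majorant hP hF]
  exact ENNReal.add_ne_top.2 ⟨hPi.2.ne, hFi.2.ne⟩

lemma lintegral_strip_comp {h : ℝ → ℝ≥0∞} (hh : Measurable h) (σ : ℝ) (I : Set ℝ) :
    ∫⁻ z in I ×ˢ univ, h (z.2 + σ * z.1) = volume I * ∫⁻ y, h y := by
  rw [Measure.volume_eq_prod, ← Measure.prod_restrict, Measure.restrict_univ,
    lintegral_prod _ (by fun_prop)]
  have : ∀ τ : ℝ, ∫⁻ y, h (y + σ * τ) = ∫⁻ y, h y := fun τ => lintegral_add_right_eq_self h _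
  simp only [this, lintegral_const, Measure.restrict_apply MeasurableSet.univ, univ_inter]
  rw [mul_comm]

lemma ae_integrable_char {F : ℝ × ℝ → E} (hF : Integrable F) (σ : ℝ) :
    ∀ᵐ y, Integrable fun τ => F (τ, y - σ * τ) := by
  have h1 : Integrable (fun z : ℝ × ℝ => F (z.1, z.2 + (0 - σ * z.1))) (volume.prod volume) :=
    (measurePreserving_shear_add σ 0).integrable_comp_of_integrable hF
  filter_upwards [h1.prod_left_ae] with y hy
  simpa [sub_eq_add_neg] using hy

lemma quasiMeasurePreserving_char (σ : ℝ) :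
    Measure.QuasiMeasurePreserving (fun z : ℝ × ℝ => z.2 + σ * z.1) volume volume :=
  Measure.quasiMeasurePreserving_snd.comp (measurePreserving_shear σ).quasiMeasurePreserving

variable [NormedSpace ℝ E]

lemma stronglyMeasurable_charIntegral {σ : ℝ} {F : ℝ × ℝ → E} (hF : StronglyMeasurable F) :
    StronglyMeasurable (charIntegral σ F) := by
  have h1 : StronglyMeasurable fun w : (ℝ × ℝ) × ℝ =>
      {w : (ℝ × ℝ) × ℝ | w.2 ∈ Ioc 0 w.1.1}.indicator
        (fun w => F (w.2, w.1.2 + σ * w.1.1 - σ * w.2)) w :=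
    (hF.comp_measurable (by fun_prop)).indicator
      ((measurableSet_lt (f := fun _ => 0) (g := fun w : (ℝ × ℝ) × ℝ => w.2)
          (by fun_prop) (by fun_prop)).inter
        (measurableSet_le (f := fun w : (ℝ × ℝ) × ℝ => w.2) (g := fun w => w.1.1)
          (by fun_prop) (by fun_prop)))
  convert h1.integral_prod_right' (ν := volume) using 1
  ext z
  rw [charIntegral, ← integral_indicator measurableSet_Ioc]
  rfl

lemma stronglyMeasurable_charDeriv {σ : ℝ} {P : ℝ → E} {F : ℝ × ℝ → E}
    (hP : StronglyMeasurable P) (hF : StronglyMeasurable F) :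
    StronglyMeasurable (charDeriv σ P F) :=
  (hP.comp_measurable (by fun_prop)).add (stronglyMeasurable_charIntegral hF)

/-- The bound depends on `z` only through `z.2 + σ * z.1`; this is what makes products of opposite
families integrable. It holds at every point, because the Bochner integral of a non-integrable
function is 0. -/
lemma enorm_charDeriv_le (σ : ℝ) (P : ℝ → E) (F : ℝ × ℝ → E) (z : ℝ × ℝ) :
    ‖charDeriv σ P F z‖ₑ ≤ majorant σ P F (z.2 + σ * z.1) := by
  refine (enorm_add_le _ _).trans (add_le_add le_rfl ?_)
  exact (enorm_integral_le_lintegral_enorm _).trans (setLIntegral_le_lintegral _ _)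

/-- The data cancel. The two integrals may be subtracted only on characteristics where both sources
are integrable, hence the restriction to almost every `z`. -/
lemma ae_enorm_charDeriv_sub_le (σ : ℝ) (P : ℝ → E) {F G : ℝ × ℝ → E} (hF : Integrable F)
    (hG : Integrable G) :
    ∀ᵐ z : ℝ × ℝ, ‖charDeriv σ P F z - charDeriv σ P G z‖ₑ
      ≤ ∫⁻ τ in Ioc 0 z.1, ‖F (τ, z.2 + σ * z.1 - σ * τ) - G (τ, z.2 + σ * z.1 - σ * τ)‖ₑ := by
  filter_upwards [(quasiMeasurePreserving_char σ).ae (ae_integrable_char hF σ),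
    (quasiMeasurePreserving_char σ).ae (ae_integrable_char hG σ)] with z h1 h2
  rw [charDeriv, charDeriv, add_sub_add_left_eq_sub, charIntegral, charIntegral,
    ← integral_sub h1.integrableOn h2.integrableOn]
  exact enorm_integral_le_lintegral_enorm _

lemma integrableOn_charDeriv {σ : ℝ} {P : ℝ → E} {F : ℝ × ℝ → E} (hP : StronglyMeasurable P)
    (hF : StronglyMeasurable F) (hPi : Integrable P) (hFi : Integrable F) (T : ℝ) :
    IntegrableOn (charDeriv σ P F) (Icc 0 T ×ˢ univ) := by
  refine ⟨(stronglyMeasurable_charDeriv hP hF).aestronglyMeasurable, ?_⟩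
  rw [hasFiniteIntegral_iff_enorm]
  refine (lintegral_mono fun z => enorm_charDeriv_le σ P F z).trans_lt ?_
  rw [lintegral_strip_comp (measurable_majorant hP hF)]
  exact ENNReal.mul_lt_top (by simp) (lintegral_majorant_ne_top hP hF hPi hFi).lt_top

end Majorant

/-! ### Continuity of translations in `L¹`. -/

section Translation

variable {E : Type*} [NormedAddCommGroup E]

lemma tendsto_lintegral_translate {h : ℝ → E} (hh : Integrable h) (σ s : ℝ) :
    Tendsto (fun t => ∫⁻ x, ‖h (x + σ * t) - h (x + σ * s)‖ₑ) (𝓝 s) (𝓝 0) := by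
  have hL : MemLp h 1 volume := memLp_one_iff_integrable.2 hh
  let g : ℝ → C(ℝ, ℝ) := fun t => ⟨fun x => x + σ * t, by fun_prop⟩
  have hg : Continuous g := by
    refine ContinuousMap.continuous_of_continuous_uncurry _ ?_
    change Continuous fun p : ℝ × ℝ => p.2 + σ * p.1
    fun_prop
  have hgm : ∀ t, MeasurePreserving (g t) volume volume := fun t =>
    measurePreserving_add_right volume (σ * t)
  have key := (tendsto_const_nhds (x := hL.toLp h) (f := 𝓝 s)).compMeasurePreservingLp
    (hg.tendsto s) hgm (hgm s) (by simp)
  simp only [Lp.toLp_compMeasurePreserving] at key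
  rw [Lp.tendsto_Lp_iff_tendsto_eLpNorm'' _ (fun t => hL.comp_measurePreserving (hgm t)) _
    (hL.comp_measurePreserving (hgm s))] at key
  simp only [eLpNorm_one_eq_lintegral_enorm] at key
  exact key

end Translation

/-! ### Linearity, uniqueness and restriction of weak derivatives. -/

section WeakDerivAlgebra

variable {n : ℕ} {Ω : Set (ℝ × ℝ)} {u w w₁ w₂ : ℝ × ℝ → Vec n} {e e₁ e₂ : ℝ × ℝ}

lemma LocallyIntegrableOn.integrableOn_smul {E : Type*} [NormedAddCommGroup E] [NormedSpace ℝ E]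
    {w : ℝ × ℝ → E} (hw : LocallyIntegrableOn w Ω)
    {φ : ℝ × ℝ → ℝ} (hφ : Continuous φ) (hφc : HasCompactSupport φ) (hφΩ : tsupport φ ⊆ Ω) :
    Integrable fun z => φ z • w z := by
  have h := (hw.integrableOn_compact_subset hφΩ hφc).continuousOn_smul hφ.continuousOn hφc
  rwa [integrableOn_iff_integrable_of_support_subset] at h
  intro z hz
  refine subset_tsupport _ fun h0 => hz ?_
  simp [h0]

lemma integrable_fderiv_smul (hu : LocallyIntegrableOn u Ω) {φ : ℝ × ℝ → ℝ}
    (hφ : ContDiff ℝ ∞ φ) (hφc : HasCompactSupport φ) (hφΩ : tsupport φ ⊆ Ω) (e : ℝ × ℝ) :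
    Integrable fun z => fderiv ℝ φ z e • u z := by
  have hsub : tsupport (fun z => fderiv ℝ φ z e) ⊆ tsupport φ :=
    tsupport_fderiv_apply_subset ℝ e
  exact LocallyIntegrableOn.integrableOn_smul hu
    ((hφ.continuous_fderiv (by simp)).clm_apply continuous_const)
    (hφc.mono' (subset_tsupport _ |>.trans hsub)) (hsub.trans hφΩ)

lemma HasWeakDerivOn.lincomb (h₁ : HasWeakDerivOn Ω e₁ u w₁) (h₂ : HasWeakDerivOn Ω e₂ u w₂)
    (a b : ℝ) : HasWeakDerivOn Ω (a • e₁ + b • e₂) u (fun z => a • w₁ z + b • w₂ z) := by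
  refine ⟨h₁.1, ?_, fun φ hφ hφc hφΩ => ?_⟩
  · exact (h₁.2.1.smul a).add (h₂.2.1.smul b)
  · have i1 := (integrable_fderiv_smul h₁.1 hφ hφc hφΩ e₁).integrableOn (s := Ω)
    have i2 := (integrable_fderiv_smul h₁.1 hφ hφc hφΩ e₂).integrableOn (s := Ω)
    have j1 := (LocallyIntegrableOn.integrableOn_smul h₁.2.1 hφ.continuous hφc hφΩ).integrableOn
      (s := Ω)
    have j2 := (LocallyIntegrableOn.integrableOn_smul h₂.2.1 hφ.continuous hφc hφΩ).integrableOn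
      (s := Ω)
    have e1 : ∀ z, fderiv ℝ φ z (a • e₁ + b • e₂) • u z
        = a • (fderiv ℝ φ z e₁ • u z) + b • (fderiv ℝ φ z e₂ • u z) := fun z => by
      rw [map_add, map_smul, map_smul, add_smul, smul_assoc, smul_assoc]
    have e2 : ∀ z, φ z • (a • w₁ z + b • w₂ z) = a • (φ z • w₁ z) + b • (φ z • w₂ z) := fun z => by
      module
    simp only [e1, e2]
    have k1 := integral_add (i1.smul a) (i2.smul b)
    have k2 := integral_add (j1.smul a) (j2.smul b)
    simp only [Pi.smul_apply] at k1 k2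
    rw [k1, k2, integral_smul, integral_smul, integral_smul, integral_smul, h₁.2.2 φ hφ hφc hφΩ,
      h₂.2.2 φ hφ hφc hφΩ]
    module

lemma HasWeakDerivOn.ae_eq {u' : ℝ × ℝ → Vec n} (hΩ : IsOpen Ω) (h₁ : HasWeakDerivOn Ω e u w₁)
    (h₂ : HasWeakDerivOn Ω e u' w₂) (hu : EqOn u u' Ω) : w₁ =ᵐ[volume.restrict Ω] w₂ := by
  have := hΩ.ae_eq_zero_of_integral_contDiff_smul_eq_zero (μ := volume) (f := w₁ - w₂)
    (h₁.2.1.sub h₂.2.1) fun φ hφ hφc hφΩ => by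
      have j1 := (LocallyIntegrableOn.integrableOn_smul h₁.2.1 hφ.continuous hφc hφΩ)
      have j2 := (LocallyIntegrableOn.integrableOn_smul h₂.2.1 hφ.continuous hφc hφΩ)
      have h0 : ∫ z in Ω, fderiv ℝ φ z e • u z = ∫ z in Ω, fderiv ℝ φ z e • u' z :=
        setIntegral_congr_fun hΩ.measurableSet fun z hz => by simp only [hu hz]
      have h3 := (h₁.2.2 φ hφ hφc hφΩ).symm.trans (h0.trans (h₂.2.2 φ hφ hφc hφΩ))
      rw [neg_inj, setIntegral_eq_integral_of_forall_compl_eq_zero,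
        setIntegral_eq_integral_of_forall_compl_eq_zero] at h3
      · simp only [Pi.sub_apply, smul_sub]
        rw [integral_sub j1 j2, h3, sub_self]
      all_goals
        intro z hz
        rw [image_eq_zero_of_notMem_tsupport fun hc => hz (hφΩ hc), zero_smul]
  rw [EventuallyEq, ae_restrict_iff' hΩ.measurableSet]
  filter_upwards [this] with z hz hzΩ
  exact sub_eq_zero.1 (hz hzΩ)

lemma HasWeakDerivOn.mono {Ω' : Set (ℝ × ℝ)} (h : HasWeakDerivOn Ω e u w) (hΩm : MeasurableSet Ω)
    (hΩ : Ω' ⊆ Ω) : HasWeakDerivOn Ω' e u w := by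
  refine ⟨h.1.mono_set hΩ, h.2.1.mono_set hΩ, fun φ hφ hφc hφΩ => ?_⟩
  have key := h.2.2 φ hφ hφc (hφΩ.trans hΩ)
  have hsub : tsupport (fun z => fderiv ℝ φ z e) ⊆ tsupport φ := tsupport_fderiv_apply_subset ℝ e
  rw [setIntegral_eq_of_subset_of_forall_sdiff_eq_zero hΩm hΩ fun z hz => ?_,
    setIntegral_eq_of_subset_of_forall_sdiff_eq_zero hΩm hΩ fun z hz => ?_] at key
  · exact key
  · rw [image_eq_zero_of_notMem_tsupport fun hc => hz.2 (hφΩ hc), zero_smul]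
  · have : fderiv ℝ φ z e = 0 := image_eq_zero_of_notMem_tsupport (f := fun z => fderiv ℝ φ z e)
      fun hc => hz.2 (hφΩ (hsub hc))
    rw [this, zero_smul]

end WeakDerivAlgebra

/-! ### Weak derivatives of the wave and their continuity in time. -/

section TimeContinuity

variable {n : ℕ}

lemma isClosed_compactTrapezoid (x₀ L T : ℝ) : IsClosed (compactTrapezoid x₀ L T) := by
  have : compactTrapezoid x₀ L T = {q | 0 ≤ q.1} ∩ {q | q.1 ≤ T} ∩ {q | x₀ - L + q.1 ≤ q.2}
      ∩ {q | q.2 ≤ x₀ + L - q.1} := by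
    ext q; simp [compactTrapezoid, mem_Icc, and_assoc]
  rw [this]
  refine (((isClosed_le ?_ ?_).inter (isClosed_le ?_ ?_)).inter (isClosed_le ?_ ?_)).inter
    (isClosed_le ?_ ?_) <;> fun_prop

lemma pos_of_mem_interior {K : Set (ℝ × ℝ)} (hK : ∀ z ∈ K, 0 ≤ z.1) {z : ℝ × ℝ}
    (hz : z ∈ interior K) : 0 < z.1 := by
  have h1 : z ∈ interior (Prod.fst ⁻¹' Ici (0 : ℝ)) := interior_mono (fun w hw => hK w hw) hz
  rw [← isOpenMap_fst.preimage_interior_eq_interior_preimage continuous_fst, interior_Ici] at h1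
  exact h1

/-- The derivatives in the directions `(1, 1)` and `(1, -1)` are known from `wave_char`; half their
sum and half their difference are `∂ₜ` and `∂ₓ`. -/
lemma hasWeakDerivOn_wave {U v g : ℝ → Vec n} {F : ℝ × ℝ → Vec n} {Ω : Set (ℝ × ℝ)}
    (hΩo : IsOpen Ω) (hΩ : ∀ z ∈ Ω, 0 < z.1) (hFm : StronglyMeasurable F) (hF : Integrable F)
    (hvm : StronglyMeasurable v) (hv : Integrable v) (hgm : StronglyMeasurable g)
    (hg : Integrable g) (hUc : Continuous U) (hU : ∀ x y, U x = U y + ∫ z in y..x, g z) :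
    HasWeakDerivOn Ω (1, 0) (wave U v F) (fun z => (1 / 2 : ℝ) • charDeriv 1 (v + (1 : ℝ) • g) F z
        + (1 / 2 : ℝ) • charDeriv (-1) (v + (-1 : ℝ) • g) F z) ∧
      HasWeakDerivOn Ω (0, 1) (wave U v F) (fun z => (1 / 2 : ℝ) • charDeriv 1 (v + (1 : ℝ) • g) F z
        + (-(1 / 2) : ℝ) • charDeriv (-1) (v + (-1 : ℝ) • g) F z) := by
  have key : ∀ σ : ℝ, σ = 1 ∨ σ = -1 →
      HasWeakDerivOn Ω (1, σ) (wave U v F) (charDeriv σ (v + σ • g) F) := fun σ hσ =>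
    hasWeakDerivOn_of_primitive hΩo hΩ (continuousOn_wave hUc hv hF)
      (integrableOn_charDeriv (hvm.add (hgm.const_smul σ)) hFm (hv.add (hg.smul σ)) hF)
      fun y s hs => wave_char hσ hFm hF hv hg hU hs y
  have h1 := (key 1 (Or.inl rfl)).lincomb (key (-1) (Or.inr rfl)) (1 / 2) (1 / 2)
  have h2 := (key 1 (Or.inl rfl)).lincomb (key (-1) (Or.inr rfl)) (1 / 2) (-(1 / 2))
  norm_num at h1 h2
  norm_num
  exact ⟨h1, h2⟩

variable {σ : ℝ} {P : ℝ → Vec n} {F : ℝ × ℝ → Vec n}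

/-- Following the characteristics, the data terms cancel and only the source between the times `s`
and `t` remains. -/
lemma lintegral_charDeriv_sub_le (hF : Integrable F) (hFm : StronglyMeasurable F) {s t : ℝ}
    (hs : 0 ≤ s) (ht : 0 ≤ t) :
    ∫⁻ y, ‖charDeriv σ P F (t, y - σ * t) - charDeriv σ P F (s, y - σ * s)‖ₑ
      ≤ ∫⁻ z in uIoc s t ×ˢ univ, ‖F z‖ₑ := by
  rw [← lintegral_char hFm.enorm σ]
  refine lintegral_mono_ae ?_
  filter_upwards [ae_integrable_char hF σ] with y hy
  simp only [charDeriv, charIntegral, sub_add_cancel]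
  rw [add_sub_add_left_eq_sub, ← intervalIntegral.integral_of_le hs,
    ← intervalIntegral.integral_of_le ht,
    intervalIntegral.integral_interval_sub_left hy.intervalIntegrable hy.intervalIntegrable]
  have := intervalIntegral.norm_intervalIntegral_eq (fun τ => F (τ, y - σ * τ)) s t volume
  rw [enorm_eq_iff_norm_eq.2 this]
  exact enorm_integral_le_lintegral_enorm _

lemma tendsto_lintegral_strip {h : ℝ × ℝ → ℝ≥0∞} (hh : Measurable h) (hi : ∫⁻ z, h z ≠ ⊤) (s : ℝ) :
    Tendsto (fun t => ∫⁻ z in uIoc s t ×ˢ univ, h z) (𝓝 s) (𝓝 0) := by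
  have e : ∀ t, ∫⁻ z in uIoc s t ×ˢ univ, h z = ∫⁻ τ in uIoc s t, ∫⁻ y, h (τ, y) := fun t => by
    rw [Measure.volume_eq_prod, ← Measure.prod_restrict, Measure.restrict_univ,
      lintegral_prod _ hh.aemeasurable]
  simp only [e]
  refine tendsto_setLIntegral_zero ?_ ?_
  · rwa [← lintegral_prod _ hh.aemeasurable, ← Measure.volume_eq_prod]
  · have : ∀ t, volume (uIoc s t) = ENNReal.ofReal |t - s| := fun t => Real.volume_uIoc
    simp only [Function.comp_def, this]
    have hc : Continuous fun t : ℝ => ENNReal.ofReal |t - s| :=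
      ENNReal.continuous_ofReal.comp (by fun_prop)
    simpa using hc.tendsto s

lemma memCL1_charDeriv (hPm : StronglyMeasurable P) (hFm : StronglyMeasurable F)
    (hP : Integrable P) (hF : Integrable F) (x₀ L T : ℝ) :
    MemCL1 (compactTrapezoid x₀ L T) T (charDeriv σ P F) := by
  set K := compactTrapezoid x₀ L T with hK
  have hKm : MeasurableSet K := (isClosed_compactTrapezoid x₀ L T).measurableSet
  have hwm := stronglyMeasurable_charDeriv (σ := σ) hPm hFm
  have hslice : ∀ t, Integrable fun x => charDeriv σ P F (t, x) := fun t => by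
    refine ⟨(hwm.comp_measurable measurable_prodMk_left).aestronglyMeasurable, ?_⟩
    rw [hasFiniteIntegral_iff_enorm]
    refine (lintegral_mono fun x => enorm_charDeriv_le σ P F (t, x)).trans_lt ?_
    rw [lintegral_add_right_eq_self (majorant σ P F) (σ * t)]
    exact (lintegral_majorant_ne_top hPm hFm hP hF).lt_top
  have hsm : ∀ t, Measurable fun x => K.indicator (charDeriv σ P F) (t, x) := fun t =>
    (hwm.measurable.indicator hKm).comp measurable_prodMk_left
  refine ⟨fun t _ => ?_, fun s hs => ?_⟩
  · rw [memLp_one_iff_integrable]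
    refine Integrable.mono (hslice t).integrableOn (hsm t).aestronglyMeasurable ?_
    exact ae_of_all _ fun x => norm_indicator_le_norm_self _ _
  · set h : ℝ → ℝ → Vec n := fun t y => charDeriv σ P F (t, y - σ * t) with hh
    have hhm : ∀ t, Measurable (h t) := fun t => hwm.measurable.comp (by fun_prop)
    have hhs : Integrable (h s) := (hslice s).comp_sub_right (σ * s)
    -- The increment from `s` to `t` has three parts: the source received in between, the
    -- translation of the profile at time `s`, and `D`, the mass of that profile where the two
    -- slices of the trapezoid differ.
    set D : ℝ → ℝ → ℝ≥0∞ := fun t x =>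
      ({x | (t, x) ∈ K ↔ (s, x) ∈ K}ᶜ).indicator (fun x => ‖h s (x + σ * s)‖ₑ) x with hD
    have hDm : ∀ t, Measurable (D t) := fun t => by
      refine Measurable.indicator ((hhm s).comp (by fun_prop)).enorm ?_
      exact (MeasurableSet.iff (hKm.preimage measurable_prodMk_left)
        (hKm.preimage measurable_prodMk_left)).compl
    have hpt : ∀ t x, ‖K.indicator (charDeriv σ P F) (t, x) - K.indicator (charDeriv σ P F) (s, x)‖ₑ
        ≤ ‖h t (x + σ * t) - h s (x + σ * t)‖ₑ + ‖h s (x + σ * t) - h s (x + σ * s)‖ₑ + D t x := by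
      intro t x
      have e1 : ∀ t, charDeriv σ P F (t, x) = h t (x + σ * t) := fun t => by simp [hh]
      have tri : ∀ a b c : Vec n, ‖a - c‖ₑ ≤ ‖a - b‖ₑ + ‖b - c‖ₑ := fun a b c => by
        simpa [edist_eq_enorm_sub] using edist_triangle a b c
      by_cases h1 : (t, x) ∈ K <;> by_cases h2 : (s, x) ∈ K
      · rw [indicator_of_mem h1, indicator_of_mem h2, e1, e1]
        exact (tri _ _ _).trans le_self_add
      · have hx : D t x = ‖h s (x + σ * s)‖ₑ := indicator_of_mem (by simp [h1, h2]) _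
        rw [indicator_of_mem h1, indicator_of_notMem h2, e1, hx]
        have := (tri (h t (x + σ * t)) (h s (x + σ * s)) 0)
        simp only [sub_zero] at this ⊢
        exact this.trans (add_le_add (tri _ _ _) le_rfl)
      · have hx : D t x = ‖h s (x + σ * s)‖ₑ := indicator_of_mem (by simp [h1, h2]) _
        rw [indicator_of_notMem h1, indicator_of_mem h2, e1, hx, zero_sub, enorm_neg]
        exact le_add_self
      · rw [indicator_of_notMem h1, indicator_of_notMem h2]; simp
    have hDlim : Tendsto (fun t => ∫⁻ x, D t x) (𝓝[Icc 0 T] s) (𝓝 0) := by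
      have : Tendsto (fun t => ∫⁻ x, D t x) (𝓝[Icc 0 T] s) (𝓝 (∫⁻ _ : ℝ, 0)) := by
        refine tendsto_lintegral_filter_of_dominated_convergence
          (fun x => ‖h s (x + σ * s)‖ₑ) (Eventually.of_forall hDm) ?_ ?_ ?_
        · exact Eventually.of_forall fun t => ae_of_all _ fun x => indicator_le_self _ _ _
        · exact (hhs.comp_add_right (σ * s)).2.ne
        -- Except at the two endpoints of the slice at time `s`, a point lies in both or in neither
        -- of the slices at `s` and `t` once `t` is close to `s` in `[0, T]`.
        · have : ∀ᵐ x : ℝ, x ∉ ({x₀ - L + s, x₀ + L - s} : Set ℝ) :=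
            compl_mem_ae_iff.2 ((Set.toFinite _).measure_zero volume)
          filter_upwards [this] with x hx
          simp only [mem_insert_iff, mem_singleton_iff, not_or] at hx
          refine tendsto_const_nhds.congr' ?_
          have c1 : Continuous fun t : ℝ => x₀ - L + t := by fun_prop
          have c2 : Continuous fun t : ℝ => x₀ + L - t := by fun_prop
          have ev1 : ∀ᶠ t in 𝓝 s, (x₀ - L + t ≤ x ↔ x₀ - L + s ≤ x) := by
            rcases lt_or_gt_of_ne hx.1 with h | h
            · filter_upwards [c1.tendsto s |>.eventually (lt_mem_nhds h)] with t ht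
              exact ⟨fun h' => absurd h' (not_le.2 ht), fun h' => absurd h' (not_le.2 h)⟩
            · filter_upwards [c1.tendsto s |>.eventually (gt_mem_nhds h)] with t ht
              exact ⟨fun _ => h.le, fun _ => ht.le⟩
          have ev2 : ∀ᶠ t in 𝓝 s, (x ≤ x₀ + L - t ↔ x ≤ x₀ + L - s) := by
            rcases lt_or_gt_of_ne hx.2 with h | h
            · filter_upwards [c2.tendsto s |>.eventually (lt_mem_nhds h)] with t ht
              exact ⟨fun _ => h.le, fun _ => ht.le⟩
            · filter_upwards [c2.tendsto s |>.eventually (gt_mem_nhds h)] with t ht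
              exact ⟨fun h' => absurd h' (not_le.2 ht), fun h' => absurd h' (not_le.2 h)⟩
          filter_upwards [nhdsWithin_le_nhds ev1, nhdsWithin_le_nhds ev2, self_mem_nhdsWithin]
            with t h1 h2 ht
          symm
          refine indicator_of_notMem ?_ _
          simp only [hK, compactTrapezoid, mem_compl_iff, not_not, mem_ofPred_eq, ht, hs, true_and,
            mem_Icc (a := x₀ - L + _), h1, h2]
      simpa using this
    have hlim := (((tendsto_lintegral_strip hFm.enorm hF.2.ne s).mono_left
      (nhdsWithin_le_nhds (s := Icc 0 T))).add ((tendsto_lintegral_translate hhs σ s).mono_left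
      (nhdsWithin_le_nhds (s := Icc 0 T)))).add hDlim
    simp only [add_zero] at hlim
    refine tendsto_of_tendsto_of_tendsto_of_le_of_le' tendsto_const_nhds hlim
      (Eventually.of_forall fun _ => zero_le) ?_
    filter_upwards [self_mem_nhdsWithin] with t ht
    rw [eLpNorm_one_eq_lintegral_enorm]
    refine (setLIntegral_le_lintegral _ _).trans ((lintegral_mono fun x => hpt t x).trans ?_)
    rw [lintegral_add_right _ (hDm t), lintegral_add_right _ (by
      exact (((hhm s).comp (measurable_add_const _)).sub
        ((hhm s).comp (measurable_add_const _))).enorm)]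
    gcongr
    rw [lintegral_add_right_eq_self (fun y => ‖h t y - h s y‖ₑ) (σ * t)]
    exact lintegral_charDeriv_sub_le hF hFm hs.1 ht.1

lemma MemCL1.lincomb {K : Set (ℝ × ℝ)} {T : ℝ} {w₁ w₂ : ℝ × ℝ → Vec n} (h₁ : MemCL1 K T w₁)
    (h₂ : MemCL1 K T w₂) (a b : ℝ) : MemCL1 K T fun z => a • w₁ z + b • w₂ z := by
  have e : ∀ z, K.indicator (fun z => a • w₁ z + b • w₂ z) z
      = a • K.indicator w₁ z + b • K.indicator w₂ z := fun z => by
    by_cases hz : z ∈ K <;> simp [hz]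
  refine ⟨fun t ht => ?_, fun s hs => ?_⟩
  · simp only [e]
    exact ((h₁.1 t ht).const_smul a).add ((h₂.1 t ht).const_smul b)
  · have hlim := (ENNReal.Tendsto.const_mul (a := ‖a‖ₑ) (h₁.2 s hs) (Or.inr enorm_ne_top)).add
      (ENNReal.Tendsto.const_mul (a := ‖b‖ₑ) (h₂.2 s hs) (Or.inr enorm_ne_top))
    simp only [mul_zero, add_zero] at hlim
    refine tendsto_of_tendsto_of_tendsto_of_le_of_le' tendsto_const_nhds hlim
      (Eventually.of_forall fun _ => zero_le) ?_
    filter_upwards [self_mem_nhdsWithin] with t ht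
    have e2 : (fun x => K.indicator (fun z => a • w₁ z + b • w₂ z) (t, x)
        - K.indicator (fun z => a • w₁ z + b • w₂ z) (s, x))
        = (a • fun x => K.indicator w₁ (t, x) - K.indicator w₁ (s, x))
          + b • fun x => K.indicator w₂ (t, x) - K.indicator w₂ (s, x) := by
      ext1 x
      simp only [e, Pi.add_apply, Pi.smul_apply]
      module
    rw [e2]
    refine (eLpNorm_add_le ?_ ?_ le_rfl).trans ?_
    · exact ((h₁.1 t ht).sub (h₁.1 s hs)).1.const_smul a
    · exact ((h₂.1 t ht).sub (h₂.1 s hs)).1.const_smul b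
    · rw [eLpNorm_const_smul, eLpNorm_const_smul]

end TimeContinuity

/-! ### The null form and its bounds. -/

section Nonlinearity

variable {n : ℕ}

/-- The right-hand side of the equation in terms of `p = ∂ₜu + ∂ₓu` and `q = ∂ₜu - ∂ₓu`. -/
noncomputable def nullRHS (Γ : Fin n → Fin n → Vec n → Vec n) (P : Vec n → Vec n →L[ℝ] Vec n)
    (u p q f : Vec n) : Vec n :=
  (∑ j, ∑ k, ((1 / 2 : ℝ) * (p j * q k + q j * p k)) • Γ j k u) + P u f

variable {Γ : Fin n → Fin n → Vec n → Vec n} {P : Vec n → Vec n →L[ℝ] Vec n}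

/-- Substituting p and q, the terms with two factors p or two factors q cancel between the time and
space products. -/
lemma forcedRHS_eq_nullRHS {u ut ux f : ℝ × ℝ → Vec n} {z : ℝ × ℝ} {p q : Vec n}
    (ht : ut z = (1 / 2 : ℝ) • p + (1 / 2 : ℝ) • q)
    (hx : ux z = (1 / 2 : ℝ) • p + (-(1 / 2) : ℝ) • q) :
    forcedRHS Γ P u ut ux f z = nullRHS Γ P (u z) p q (f z) := by
  simp only [forcedRHS, nullRHS, ht, hx, Pi.add_apply, Pi.smul_apply, smul_eq_mul]
  congr 1
  refine Finset.sum_congr rfl fun j _ => Finset.sum_congr rfl fun k _ => ?_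
  congr 1
  ring

/-- Every quadratic term of both bounds pairs one factor of p-type with one of q-type, as the
transversal estimate requires. -/
lemma exists_nullRHS_bounds (hΓ : ∀ j k, BoundedLipschitz (Γ j k)) (hP : BoundedLipschitz P) :
    ∃ M : ℝ≥0, (∀ u p q f, ‖nullRHS Γ P u p q f‖ₑ ≤ M * (‖p‖ₑ * ‖q‖ₑ + ‖f‖ₑ)) ∧
      ∀ u u' p p' q q' f, ‖nullRHS Γ P u p q f - nullRHS Γ P u' p' q' f‖ₑ
        ≤ M * (‖u - u'‖ₑ * (‖p‖ₑ * ‖q‖ₑ + ‖f‖ₑ) + ‖p - p'‖ₑ * ‖q‖ₑ + ‖p'‖ₑ * ‖q - q'‖ₑ) := by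
  choose C hC hCL using hΓ
  obtain ⟨C', hC', hCL'⟩ := hP
  have hb : ∀ (p q : Vec n) j k, ‖(1 / 2 : ℝ) * (p j * q k + q j * p k)‖ ≤ ‖p‖ * ‖q‖ := by
    intro p q j k
    have h1 := mul_le_mul (norm_le_pi_norm p j) (norm_le_pi_norm q k) (norm_nonneg _) (norm_nonneg _)
    have h2 := mul_le_mul (norm_le_pi_norm p k) (norm_le_pi_norm q j) (norm_nonneg _) (norm_nonneg _)
    have h3 := norm_add_le (p j * q k) (q j * p k)
    rw [norm_mul, norm_mul, mul_comm ‖q j‖] at h3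
    rw [norm_mul, Real.norm_of_nonneg (by norm_num : (0 : ℝ) ≤ 1 / 2)]
    linarith
  refine ⟨(∑ j, ∑ k, C j k) + C', ?_, ?_⟩
  · intro u p q f
    have hr : ‖nullRHS Γ P u p q f‖ ≤ (((∑ j, ∑ k, C j k) + C' : ℝ≥0) : ℝ) * (‖p‖ * ‖q‖ + ‖f‖) := by
      push_cast
      have hs : ‖∑ j, ∑ k, ((1 / 2 : ℝ) * (p j * q k + q j * p k)) • Γ j k u‖
          ≤ (∑ j, ∑ k, (C j k : ℝ)) * (‖p‖ * ‖q‖) := by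
        rw [Finset.sum_mul]
        refine norm_sum_le_of_le _ fun j _ => ?_
        rw [Finset.sum_mul]
        refine norm_sum_le_of_le _ fun k _ => ?_
        rw [norm_smul, mul_comm]
        exact mul_le_mul (hC j k u) (hb p q j k) (norm_nonneg _) (C j k).2
      have hp : ‖P u f‖ ≤ C' * ‖f‖ :=
        ((P u).le_opNorm f).trans (mul_le_mul_of_nonneg_right (hC' u) (norm_nonneg _))
      have h0 : 0 ≤ ∑ j, ∑ k, (C j k : ℝ) := by positivity
      have h1 := mul_nonneg h0 (norm_nonneg f)
      have h2 := mul_nonneg C'.2 (mul_nonneg (norm_nonneg p) (norm_nonneg q))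
      simp only [NNReal.val_eq_coe] at h2
      refine (norm_add_le _ _).trans ((add_le_add hs hp).trans ?_)
      nlinarith
    rw [← ofReal_norm, ← ofReal_norm, ← ofReal_norm, ← ofReal_norm, ← ENNReal.ofReal_coe_nnreal,
      ← ENNReal.ofReal_mul (norm_nonneg _), ← ENNReal.ofReal_add (by positivity) (by positivity),
      ← ENNReal.ofReal_mul (by positivity)]
    exact ENNReal.ofReal_le_ofReal hr
  · intro u u' p p' q q' f
    have hr : ‖nullRHS Γ P u p q f - nullRHS Γ P u' p' q' f‖
        ≤ (((∑ j, ∑ k, C j k) + C' : ℝ≥0) : ℝ) * (‖u - u'‖ * (‖p‖ * ‖q‖ + ‖f‖) + ‖p - p'‖ * ‖q‖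
          + ‖p'‖ * ‖q - q'‖) := by
      push_cast
      set X := ‖u - u'‖ * (‖p‖ * ‖q‖) + ‖p - p'‖ * ‖q‖ + ‖p'‖ * ‖q - q'‖ with hX
      have hs : ‖(∑ j, ∑ k, ((1 / 2 : ℝ) * (p j * q k + q j * p k)) • Γ j k u)
          - ∑ j, ∑ k, ((1 / 2 : ℝ) * (p' j * q' k + q' j * p' k)) • Γ j k u'‖
          ≤ (∑ j, ∑ k, (C j k : ℝ)) * X := by
        rw [Finset.sum_mul, ← Finset.sum_sub_distrib]
        refine norm_sum_le_of_le _ fun j _ => ?_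
        rw [Finset.sum_mul, ← Finset.sum_sub_distrib]
        refine norm_sum_le_of_le _ fun k _ => ?_
        -- Telescoping: `u` is replaced first, then `p`, then `q`.
        have e : ((1 / 2 : ℝ) * (p j * q k + q j * p k)) • Γ j k u
            - ((1 / 2 : ℝ) * (p' j * q' k + q' j * p' k)) • Γ j k u'
            = ((1 / 2 : ℝ) * (p j * q k + q j * p k)) • (Γ j k u - Γ j k u')
              + ((1 / 2 : ℝ) * ((p - p') j * q k + q j * (p - p') k)) • Γ j k u'
              + ((1 / 2 : ℝ) * (p' j * (q - q') k + (q - q') j * p' k)) • Γ j k u' := by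
          simp only [Pi.sub_apply]
          module
        rw [e]
        refine (norm_add₃_le).trans ?_
        rw [norm_smul, norm_smul, norm_smul]
        have hl : ‖Γ j k u - Γ j k u'‖ ≤ C j k * ‖u - u'‖ := (hCL j k).norm_sub_le u u'
        have t1 := mul_le_mul (hb p q j k) hl (norm_nonneg _) (by positivity)
        have t2 := mul_le_mul (hb (p - p') q j k) (hC j k u') (norm_nonneg _) (by positivity)
        have t3 := mul_le_mul (hb p' (q - q') j k) (hC j k u') (norm_nonneg _) (by positivity)
        refine (add_le_add_three t1 t2 t3).trans_eq ?_
        rw [hX]; ring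
      have hp : ‖P u f - P u' f‖ ≤ C' * (‖u - u'‖ * ‖f‖) := by
        rw [← sub_apply, ← mul_assoc]
        exact ((P u - P u').le_opNorm f).trans
          (mul_le_mul_of_nonneg_right (hCL'.norm_sub_le u u') (norm_nonneg _))
      have h0 : 0 ≤ ∑ j, ∑ k, (C j k : ℝ) := by positivity
      have hXn : 0 ≤ X := by positivity
      have h1 := mul_nonneg h0 (mul_nonneg (norm_nonneg (u - u')) (norm_nonneg f))
      have h2 := mul_nonneg C'.coe_nonneg hXn
      have e3 : nullRHS Γ P u p q f - nullRHS Γ P u' p' q' f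
          = ((∑ j, ∑ k, ((1 / 2 : ℝ) * (p j * q k + q j * p k)) • Γ j k u)
          - ∑ j, ∑ k, ((1 / 2 : ℝ) * (p' j * q' k + q' j * p' k)) • Γ j k u')
            + (P u f - P u' f) := by
        simp only [nullRHS]; abel
      rw [e3]
      refine (norm_add_le _ _).trans ((add_le_add hs hp).trans ?_)
      have e4 : ‖u - u'‖ * (‖p‖ * ‖q‖ + ‖f‖) + ‖p - p'‖ * ‖q‖ + ‖p'‖ * ‖q - q'‖
          = X + ‖u - u'‖ * ‖f‖ := by rw [hX]; ring
      rw [e4]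
      nlinarith
    simp only [← ofReal_norm]
    rw [← ENNReal.ofReal_coe_nnreal, ← ENNReal.ofReal_mul (norm_nonneg _),
      ← ENNReal.ofReal_add (by positivity) (by positivity), ← ENNReal.ofReal_mul (norm_nonneg _),
      ← ENNReal.ofReal_mul (norm_nonneg _), ← ENNReal.ofReal_mul (norm_nonneg _),
      ← ENNReal.ofReal_add (by positivity) (by positivity),
      ← ENNReal.ofReal_add (by positivity) (by positivity), ← ENNReal.ofReal_mul (by positivity)]
    exact ENNReal.ofReal_le_ofReal hr

lemma continuous_nullRHS (hΓ : ∀ j k, BoundedLipschitz (Γ j k)) (hP : BoundedLipschitz P) :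
    Continuous fun w : (Vec n × Vec n) × Vec n × Vec n => nullRHS Γ P w.1.1 w.1.2 w.2.1 w.2.2 := by
  have h1 : ∀ j k, Continuous (Γ j k) := fun j k => (hΓ j k).choose_spec.2.continuous
  have h2 : Continuous P := hP.choose_spec.2.continuous
  unfold nullRHS
  fun_prop

end Nonlinearity

/-! ### Transversal product estimate and bounds for the Picard map. -/

section Picard

variable {n : ℕ}

/-- The right-hand side of the equation, cut off outside `D`, for the solution of the
inhomogeneous linear wave equation with source `F`. -/
noncomputable def picard (Γ : Fin n → Fin n → Vec n → Vec n) (P : Vec n → Vec n →L[ℝ] Vec n)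
    (D : Set (ℝ × ℝ)) (U v g : ℝ → Vec n) (f F : ℝ × ℝ → Vec n) : ℝ × ℝ → Vec n :=
  D.indicator fun z => nullRHS Γ P (wave U v F z) (charDeriv 1 (v + (1 : ℝ) • g) F z)
    (charDeriv (-1) (v + (-1 : ℝ) • g) F z) (f z)

/-- On the line `x + σt = y` the factor `A` is constant and `B` is evaluated at `y - 2σt`. The small
factor is taken from `B` alone; `A` enters with its full integral. -/
lemma lintegral_strip_mul_le {A B : ℝ → ℝ≥0∞} (hA : Measurable A) (hB : Measurable B) (σ : ℝ)
    {I : Set ℝ} {ε : ℝ≥0∞} (h : ∀ y, ∫⁻ t in I, B (y - 2 * σ * t) ≤ ε) :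
    ∫⁻ z in I ×ˢ univ, A (z.2 + σ * z.1) * B (z.2 - σ * z.1) ≤ ε * ∫⁻ y, A y := by
  rw [← lintegral_char (h := fun z => A (z.2 + σ * z.1) * B (z.2 - σ * z.1)) (by fun_prop) σ,
    ← lintegral_const_mul _ hA]
  refine lintegral_mono fun y => ?_
  have e : ∀ τ, A (y - σ * τ + σ * τ) * B (y - σ * τ - σ * τ) = A y * B (y - 2 * σ * τ) := by
    intro τ
    rw [show y - σ * τ + σ * τ = y by ring, show y - σ * τ - σ * τ = y - 2 * σ * τ by ring]
  simp only [e]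
  rw [lintegral_const_mul _ (by fun_prop), mul_comm]
  exact mul_le_mul_left (h y) _

lemma lintegral_comp_char_le {B : ℝ → ℝ≥0∞} (hB : Measurable B) {σ : ℝ} (hσ : σ = 1 ∨ σ = -1)
    (I : Set ℝ) (y : ℝ) : ∫⁻ t in I, B (y - 2 * σ * t) ≤ ∫⁻ x, B x := by
  have e : ∀ t, B (y - 2 * σ * t) = B ((-(2 * σ)) * t + y) := fun t => by congr 1; ring
  refine (setLIntegral_le_lintegral _ _).trans ?_
  simp only [e]
  have hσ' : |(-(2 * σ))⁻¹| = 1 / 2 := by rcases hσ with rfl | rfl <;> norm_num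
  rw [lintegral_comp_mul_add (by rcases hσ with rfl | rfl <;> norm_num) y hB, hσ']
  refine mul_le_of_le_one_left' ?_
  rw [← ENNReal.ofReal_one]
  exact ENNReal.ofReal_le_ofReal (by norm_num)

variable {Γ : Fin n → Fin n → Vec n → Vec n} {P : Vec n → Vec n →L[ℝ] Vec n}
  {D : Set (ℝ × ℝ)} {U v g : ℝ → Vec n} {f F G : ℝ × ℝ → Vec n}

lemma aestronglyMeasurable_picard (hΓ : ∀ j k, BoundedLipschitz (Γ j k)) (hP : BoundedLipschitz P)
    (hD : MeasurableSet D) (hD0 : ∀ z ∈ D, 0 ≤ z.1) (hU : Continuous U)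
    (hvm : StronglyMeasurable v) (hv : Integrable v) (hgm : StronglyMeasurable g)
    (hf : AEStronglyMeasurable f) (hFm : StronglyMeasurable F) (hF : Integrable F) :
    AEStronglyMeasurable (picard Γ P D U v g f F) := by
  refine (aestronglyMeasurable_indicator_iff hD).2 ?_
  have hw : AEStronglyMeasurable (wave U v F) (volume.restrict D) :=
    ((continuousOn_wave hU hv hF).mono hD0).aestronglyMeasurable hD
  have h1 : AEStronglyMeasurable (charDeriv 1 (v + (1 : ℝ) • g) F) (volume.restrict D) :=
    (stronglyMeasurable_charDeriv (hvm.add (hgm.const_smul (1 : ℝ))) hFm).aestronglyMeasurable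
  have h2 : AEStronglyMeasurable (charDeriv (-1) (v + (-1 : ℝ) • g) F) (volume.restrict D) :=
    (stronglyMeasurable_charDeriv (hvm.add (hgm.const_smul (-1 : ℝ))) hFm).aestronglyMeasurable
  have h3 := (hw.prodMk h1).prodMk (h2.prodMk hf.restrict)
  have h4 := (continuous_nullRHS hΓ hP).comp_aestronglyMeasurable h3
  simp only at h4
  exact h4

lemma enorm_picard_le {M : ℝ≥0}
    (hM : ∀ u p q f, ‖nullRHS Γ P u p q f‖ₑ ≤ M * (‖p‖ₑ * ‖q‖ₑ + ‖f‖ₑ)) (z : ℝ × ℝ) :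
    ‖picard Γ P D U v g f F z‖ₑ ≤ M * (majorant 1 (v + (1 : ℝ) • g) F (z.2 + 1 * z.1)
      * majorant (-1) (v + (-1 : ℝ) • g) F (z.2 - 1 * z.1) + ‖f z‖ₑ) := by
  by_cases hz : z ∈ D
  · rw [picard, indicator_of_mem hz]
    refine (hM _ _ _ _).trans ?_
    have h1 := enorm_charDeriv_le 1 (v + (1 : ℝ) • g) F z
    have h2 := enorm_charDeriv_le (-1) (v + (-1 : ℝ) • g) F z
    rw [show z.2 + -1 * z.1 = z.2 - 1 * z.1 by ring] at h2
    gcongr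
  · rw [picard, indicator_of_notMem hz]; simp

lemma lintegral_picard_le {M : ℝ≥0}
    (hM : ∀ u p q f, ‖nullRHS Γ P u p q f‖ₑ ≤ M * (‖p‖ₑ * ‖q‖ₑ + ‖f‖ₑ))
    (hvm : StronglyMeasurable v) (hgm : StronglyMeasurable g) (hFm : StronglyMeasurable F)
    {I : Set ℝ} {ε : ℝ≥0∞}
    (hε : ∀ y, ∫⁻ t in I, majorant (-1) (v + (-1 : ℝ) • g) F (y - 2 * 1 * t) ≤ ε) :
    ∫⁻ z in I ×ˢ univ, ‖picard Γ P D U v g f F z‖ₑ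
      ≤ M * (ε * (∫⁻ y, majorant 1 (v + (1 : ℝ) • g) F y) + ∫⁻ z in I ×ˢ univ, ‖f z‖ₑ) := by
  have m1 := measurable_majorant (σ := 1) (hvm.add (hgm.const_smul (1 : ℝ))) hFm
  have m2 := measurable_majorant (σ := -1) (hvm.add (hgm.const_smul (-1 : ℝ))) hFm
  refine (lintegral_mono fun z => enorm_picard_le hM z).trans ?_
  rw [lintegral_const_mul' _ _ ENNReal.coe_ne_top, lintegral_add_left (by fun_prop)]
  gcongr
  exact lintegral_strip_mul_le m1 m2 1 hε

lemma integrable_picard (hΓ : ∀ j k, BoundedLipschitz (Γ j k)) (hP : BoundedLipschitz P)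
    (hD : MeasurableSet D) (hD0 : ∀ z ∈ D, 0 ≤ z.1) (hU : Continuous U)
    (hvm : StronglyMeasurable v) (hv : Integrable v) (hgm : StronglyMeasurable g)
    (hg : Integrable g) (hf : Integrable f) (hFm : StronglyMeasurable F) (hF : Integrable F) :
    Integrable (picard Γ P D U v g f F) := by
  obtain ⟨M, hM, -⟩ := exists_nullRHS_bounds hΓ hP
  refine ⟨aestronglyMeasurable_picard hΓ hP hD hD0 hU hvm hv hgm hf.1 hFm hF, ?_⟩
  have key := lintegral_picard_le (D := D) (U := U) (f := f) hM hvm hgm hFm (I := univ)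
    (fun y => lintegral_comp_char_le
      (measurable_majorant (hvm.add (hgm.const_smul (-1 : ℝ))) hFm) (Or.inl rfl) univ y)
  rw [univ_prod_univ, Measure.restrict_univ] at key
  rw [hasFiniteIntegral_iff_enorm]
  refine key.trans_lt (ENNReal.mul_lt_top ENNReal.coe_lt_top
    (ENNReal.add_lt_top.2 ⟨ENNReal.mul_lt_top ?_ ?_, hf.2⟩))
  · exact (lintegral_majorant_ne_top (hvm.add (hgm.const_smul (-1 : ℝ))) hFm
      (hv.add (hg.smul (-1 : ℝ))) hF).lt_top
  · exact (lintegral_majorant_ne_top (hvm.add (hgm.const_smul (1 : ℝ))) hFm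
      (hv.add (hg.smul (1 : ℝ))) hF).lt_top

/-- Since the sources agree up to time `s`, all differences are controlled by their distance `m` on
the strip from `s` to `s'`. The difference of the waves is at most `m` and multiplies `A B + |f|`,
giving `m (ε ∫ A + ε)`. The differences of p and of q are paired with the transversal majorants `B`
and `A'`, giving `ε m` each. This accounts for the 3. -/
lemma lintegral_picard_sub_le {M : ℝ≥0}
    (hM : ∀ u u' p p' q q' f, ‖nullRHS Γ P u p q f - nullRHS Γ P u' p' q' f‖ₑ
      ≤ M * (‖u - u'‖ₑ * (‖p‖ₑ * ‖q‖ₑ + ‖f‖ₑ) + ‖p - p'‖ₑ * ‖q‖ₑ + ‖p'‖ₑ * ‖q - q'‖ₑ))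
    (hvm : StronglyMeasurable v) (hgm : StronglyMeasurable g)
    (hFm : StronglyMeasurable F) (hF : Integrable F) (hGm : StronglyMeasurable G)
    (hG : Integrable G) {s s' : ℝ} (hs : 0 ≤ s) (hss : s ≤ s')
    (hFG : ∫⁻ z in Ioc 0 s ×ˢ univ, ‖F z - G z‖ₑ = 0) {ε : ℝ≥0∞}
    (h1 : ∀ y, ∫⁻ t in Ioc s s', majorant (-1) (v + (-1 : ℝ) • g) F (y - 2 * 1 * t) ≤ ε)
    (h2 : ∀ y, ∫⁻ t in Ioc s s', majorant 1 (v + (1 : ℝ) • g) G (y - 2 * -1 * t) ≤ ε)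
    (h3 : ∫⁻ z in Ioc s s' ×ˢ univ, ‖f z‖ₑ ≤ ε) :
    ∫⁻ z in Ioc s s' ×ˢ univ, ‖picard Γ P D U v g f F z - picard Γ P D U v g f G z‖ₑ
      ≤ M * ((∫⁻ y, majorant 1 (v + (1 : ℝ) • g) F y) + 3) * ε
        * ∫⁻ z in Ioc s s' ×ˢ univ, ‖F z - G z‖ₑ := by
  set m := ∫⁻ z in Ioc s s' ×ˢ univ, ‖F z - G z‖ₑ with hm
  set e : ℝ × ℝ → ℝ≥0∞ := fun z => ‖F z - G z‖ₑ with he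
  have hem : Measurable e := (hFm.sub hGm).enorm
  set A := majorant 1 (v + (1 : ℝ) • g) F with hA
  set B := majorant (-1) (v + (-1 : ℝ) • g) F with hB
  set A' := majorant 1 (v + (1 : ℝ) • g) G with hA'
  have mA : Measurable A := measurable_majorant (hvm.add (hgm.const_smul (1 : ℝ))) hFm
  have mB : Measurable B := measurable_majorant (hvm.add (hgm.const_smul (-1 : ℝ))) hFm
  have mA' : Measurable A' := measurable_majorant (hvm.add (hgm.const_smul (1 : ℝ))) hGm
  -- Dominates the difference of the derivatives in direction `(1, σ)` up to time `s'` by a function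
  -- of `x + σt` with integral `m`.
  set E : ℝ → ℝ → ℝ≥0∞ := fun σ y => ∫⁻ τ in Ioc 0 s', e (τ, y - σ * τ) with hE
  have mE : ∀ σ, Measurable (E σ) := fun σ => measurable_lintegral_char hem σ _
  have hstrip : ∫⁻ z in Ioc 0 s' ×ˢ univ, e z = m := by
    rw [← Ioc_union_Ioc_eq_Ioc hs hss, union_prod, lintegral_union
      (measurableSet_Ioc.prod .univ), hFG, zero_add]
    refine Set.disjoint_left.2 fun z hz hz' => ?_
    exact absurd hz'.1.1 (not_lt.2 hz.1.2)
  have hEi : ∀ σ, ∫⁻ y, E σ y = m := fun σ => (lintegral_char hem σ).trans hstrip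
  have hpt : ∀ᵐ z ∂(volume.restrict (Ioc s s' ×ˢ univ)),
      ‖picard Γ P D U v g f F z - picard Γ P D U v g f G z‖ₑ
        ≤ M * (m * (A (z.2 + 1 * z.1) * B (z.2 - 1 * z.1) + ‖f z‖ₑ)
          + E 1 (z.2 + 1 * z.1) * B (z.2 - 1 * z.1)
          + E (-1) (z.2 + -1 * z.1) * A' (z.2 - -1 * z.1)) := by
    rw [ae_restrict_iff' (measurableSet_Ioc.prod .univ)]
    filter_upwards [ae_enorm_charDeriv_sub_le 1 (v + (1 : ℝ) • g) hF hG,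
      ae_enorm_charDeriv_sub_le (-1) (v + (-1 : ℝ) • g) hF hG] with z d1 d2 hz
    by_cases hzD : z ∈ D
    · rw [picard, picard, indicator_of_mem hzD, indicator_of_mem hzD]
      refine (hM _ _ _ _ _ _ _).trans ?_
      have hz0 : 0 ≤ z.1 := hs.trans hz.1.1.le
      have hsub : Ioc 0 z.1 ⊆ Ioc 0 s' := Ioc_subset_Ioc_right hz.1.2
      have b0 : ‖wave U v F z - wave U v G z‖ₑ ≤ m := by
        rw [wave, wave, add_sub_add_left_eq_sub]
        refine (enorm_duhamel_sub_le hz0 hF hG).trans ?_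
        rw [← hstrip]
        exact lintegral_mono_set (prod_mono_left hsub)
      have b1 := d1.trans (lintegral_mono_set hsub)
      have b2 := d2.trans (lintegral_mono_set hsub)
      have c1 := enorm_charDeriv_le 1 (v + (1 : ℝ) • g) F z
      have c2 := enorm_charDeriv_le (-1) (v + (-1 : ℝ) • g) F z
      have c3 := enorm_charDeriv_le 1 (v + (1 : ℝ) • g) G z
      rw [show z.2 + -1 * z.1 = z.2 - 1 * z.1 by ring] at c2
      rw [mul_comm (E (-1) _), show z.2 - -1 * z.1 = z.2 + 1 * z.1 by ring]
      gcongr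
    · rw [picard, picard, indicator_of_notMem hzD, indicator_of_notMem hzD]; simp
  refine (lintegral_mono_ae hpt).trans ?_
  rw [lintegral_const_mul' _ _ ENNReal.coe_ne_top, lintegral_add_right _ (by fun_prop),
    lintegral_add_right _ (by fun_prop)]
  have i1 := lintegral_strip_mul_le mA mB 1 h1
  have i2 := lintegral_strip_mul_le (mE 1) mB 1 h1
  have i3 := lintegral_strip_mul_le (mE (-1)) mA' (-1) h2
  rw [hEi] at i2 i3
  have i4 : ∫⁻ z in Ioc s s' ×ˢ univ, m * (A (z.2 + 1 * z.1) * B (z.2 - 1 * z.1) + ‖f z‖ₑ)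
      ≤ m * (ε * (∫⁻ y, A y) + ε) := by
    have mt : m ≠ ⊤ :=
      ((setLIntegral_le_lintegral _ _).trans_lt (hF.sub hG).2).ne
    rw [lintegral_const_mul' _ _ mt, lintegral_add_left (by fun_prop)]
    gcongr
  calc _ ≤ M * (m * (ε * (∫⁻ y, A y) + ε) + ε * m + ε * m) := by gcongr
    _ = _ := by ring

end Picard

/-! ### Existence and uniqueness of fixed points of the Picard map. -/

section FixedPoint

variable {n : ℕ}

/-- Absolute continuity of the integral. The length of an interval determines its measure, so `δ`
serves all `s` and `y` at once. -/
lemma exists_lintegral_char_le {A : ℝ → ℝ≥0∞} (hA : Measurable A) (hAi : ∫⁻ y, A y ≠ ⊤)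
    {σ : ℝ} (hσ : σ = 1 ∨ σ = -1) {ε : ℝ≥0∞} (hε : ε ≠ 0) :
    ∃ δ : ℝ, 0 < δ ∧ ∀ s y : ℝ, ∫⁻ t in Ioc s (s + δ), A (y - 2 * σ * t) ≤ ε := by
  obtain ⟨d, hd, hdA⟩ := exists_pos_setLIntegral_lt_of_measure_lt hAi hε
  obtain ⟨d', hd'0, hd'⟩ := ENNReal.lt_iff_exists_nnreal_btwn.1 hd
  have hd'1 : 0 < (d' : ℝ) := by exact_mod_cast hd'0
  -- In time `d' / 4` the argument moves by `d' / 2`, to one side or the other according to `σ`; the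
  -- symmetric interval `J` of length `d'` covers both cases.
  refine ⟨d' / 4, by positivity, fun s y => ?_⟩
  set J := Icc (y - 2 * σ * s - d' / 2) (y - 2 * σ * s + d' / 2) with hJ
  have hJv : volume J < d := by
    rw [hJ, Real.volume_Icc]
    refine lt_of_le_of_lt (le_of_eq ?_) hd'
    rw [← ENNReal.ofReal_coe_nnreal]; congr 1; ring
  have h1 : ∫⁻ t in Ioc s (s + d' / 4), A (y - 2 * σ * t)
      ≤ ∫⁻ t, J.indicator A (y - 2 * σ * t) := by
    rw [← lintegral_indicator measurableSet_Ioc]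
    refine lintegral_mono fun t => ?_
    by_cases ht : t ∈ Ioc s (s + d' / 4)
    · rw [indicator_of_mem ht, indicator_of_mem]
      rcases hσ with rfl | rfl <;> constructor <;> linarith [ht.1, ht.2]
    · rw [indicator_of_notMem ht]; exact zero_le
  have h2 := lintegral_comp_char_le (hA.indicator (measurableSet_Icc (a := y - 2 * σ * s - d' / 2)
    (b := y - 2 * σ * s + d' / 2))) hσ univ y
  rw [Measure.restrict_univ, lintegral_indicator measurableSet_Icc] at h2
  exact (h1.trans h2).trans (hdA J hJv).le

lemma exists_lintegral_strip_le {E : Type*} [NormedAddCommGroup E] {f : ℝ × ℝ → E}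
    (hf : Integrable f) {ε : ℝ≥0∞} (hε : ε ≠ 0) :
    ∃ δ : ℝ, 0 < δ ∧ ∀ s : ℝ, ∫⁻ z in Ioc s (s + δ) ×ˢ univ, ‖f z‖ₑ ≤ ε := by
  have hfm : AEMeasurable (fun z => ‖f z‖ₑ) ((volume : Measure ℝ).prod volume) := hf.1.enorm
  have hi : ∫⁻ τ : ℝ, ∫⁻ y : ℝ, ‖f (τ, y)‖ₑ ≠ ⊤ := by
    rw [← lintegral_prod _ hfm]
    exact hf.2.ne
  obtain ⟨d, hd, hdA⟩ := exists_pos_setLIntegral_lt_of_measure_lt hi hε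
  obtain ⟨d', hd'0, hd'⟩ := ENNReal.lt_iff_exists_nnreal_btwn.1 hd
  refine ⟨d', by exact_mod_cast hd'0, fun s => ?_⟩
  rw [Measure.volume_eq_prod, ← Measure.prod_restrict, Measure.restrict_univ, lintegral_prod]
  · refine (hdA _ ?_).le
    rw [Real.volume_Ioc]
    simpa using hd'
  · have := hfm.restrict (s := Ioc s (s + d') ×ˢ univ)
    rwa [← Measure.prod_restrict, Measure.restrict_univ] at this

lemma exists_mul_le_half {c : ℝ≥0∞} (hc : c ≠ ⊤) : ∃ ε : ℝ≥0∞, ε ≠ 0 ∧ ε ≠ ⊤ ∧ c * ε ≤ 1 / 2 := by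
  rcases eq_or_ne c 0 with rfl | h0
  · exact ⟨1, by simp, by simp, by simp⟩
  · exact ⟨(1 / 2) / c, (ENNReal.div_pos (by simp) hc).ne',
      (ENNReal.div_lt_top (by simp) h0).ne, ENNReal.mul_div_le⟩

variable {Γ : Fin n → Fin n → Vec n → Vec n} {P : Vec n → Vec n →L[ℝ] Vec n}
  {D : Set (ℝ × ℝ)} {U v g : ℝ → Vec n} {f F G : ℝ × ℝ → Vec n}

/-- No smallness of `F` or `G` is needed: their full majorants are integrable, so one step length
makes the difference estimate contract on every strip of that length, and finitely many strips reach
`T`. -/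
lemma picard_fixedPoint_unique (hΓ : ∀ j k, BoundedLipschitz (Γ j k)) (hP : BoundedLipschitz P)
    {T : ℝ} (hDT : D ⊆ Icc 0 T ×ˢ univ)
    (hvm : StronglyMeasurable v) (hv : Integrable v) (hgm : StronglyMeasurable g)
    (hg : Integrable g) (hf : Integrable f)
    (hFm : StronglyMeasurable F) (hF : Integrable F) (hGm : StronglyMeasurable G)
    (hG : Integrable G) (hFfix : F =ᵐ[volume] picard Γ P D U v g f F)
    (hGfix : G =ᵐ[volume] picard Γ P D U v g f G) : F =ᵐ[volume] G := by
  obtain ⟨M, -, hM⟩ := exists_nullRHS_bounds hΓ hP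
  have mF := measurable_majorant (σ := -1) (hvm.add (hgm.const_smul (-1 : ℝ))) hFm
  have mG := measurable_majorant (σ := 1) (hvm.add (hgm.const_smul (1 : ℝ))) hGm
  have iF0 := lintegral_majorant_ne_top (σ := 1) (hvm.add (hgm.const_smul (1 : ℝ))) hFm
    (hv.add (hg.smul (1 : ℝ))) hF
  have iF := lintegral_majorant_ne_top (σ := -1) (hvm.add (hgm.const_smul (-1 : ℝ))) hFm
    (hv.add (hg.smul (-1 : ℝ))) hF
  have iG := lintegral_majorant_ne_top (σ := 1) (hvm.add (hgm.const_smul (1 : ℝ))) hGm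
    (hv.add (hg.smul (1 : ℝ))) hG
  obtain ⟨ε, hε0, -, hε⟩ := exists_mul_le_half
    (c := M * ((∫⁻ y, majorant 1 (v + (1 : ℝ) • g) F y) + 3))
    (ENNReal.mul_ne_top ENNReal.coe_ne_top (ENNReal.add_ne_top.2 ⟨iF0, by simp⟩))
  obtain ⟨δ₁, hδ₁, h₁⟩ := exists_lintegral_char_le mF iF (Or.inl rfl) hε0
  obtain ⟨δ₂, hδ₂, h₂⟩ := exists_lintegral_char_le mG iG (Or.inr rfl) hε0
  obtain ⟨δ₃, hδ₃, h₃⟩ := exists_lintegral_strip_le hf hε0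
  set δ := min δ₁ (min δ₂ δ₃) with hδd
  have hδ : 0 < δ := lt_min hδ₁ (lt_min hδ₂ hδ₃)
  have l1 : δ ≤ δ₁ := min_le_left _ _
  have l2 : δ ≤ δ₂ := (min_le_right _ _).trans (min_le_left _ _)
  have l3 : δ ≤ δ₃ := (min_le_right _ _).trans (min_le_right _ _)
  have step : ∀ k : ℕ, ∫⁻ z in Ioc 0 (k * δ) ×ˢ univ, ‖F z - G z‖ₑ = 0 := by
    intro k
    induction k with
    | zero => simp
    | succ k ih =>
      have hk0 : 0 ≤ k * δ := by positivity
      have e1 : ((k + 1 : ℕ) : ℝ) * δ = k * δ + δ := by push_cast; ring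
      have key := lintegral_picard_sub_le (D := D) (U := U) (f := f) hM hvm hgm hFm hF hGm hG
        hk0 (le_add_of_nonneg_right hδ.le) ih
        (fun y => (lintegral_mono_set (Ioc_subset_Ioc_right (by linarith))).trans (h₁ (k * δ) y))
        (fun y => (lintegral_mono_set (Ioc_subset_Ioc_right (by linarith))).trans (h₂ (k * δ) y))
        ((lintegral_mono_set (prod_mono_left (Ioc_subset_Ioc_right (by linarith)))).trans
          (h₃ (k * δ)))
      have e2 : ∫⁻ z in Ioc (k * δ) (k * δ + δ) ×ˢ univ,
          ‖picard Γ P D U v g f F z - picard Γ P D U v g f G z‖ₑ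
          = ∫⁻ z in Ioc (k * δ) (k * δ + δ) ×ˢ univ, ‖F z - G z‖ₑ := by
        refine lintegral_congr_ae (ae_restrict_of_ae ?_)
        filter_upwards [hFfix, hGfix] with z a b
        rw [← a, ← b]
      rw [e2] at key
      have fin : ∫⁻ z in Ioc (k * δ) (k * δ + δ) ×ˢ univ, ‖F z - G z‖ₑ ≠ ⊤ :=
        ((setLIntegral_le_lintegral _ _).trans_lt (hF.sub hG).2).ne
      -- A finite quantity bounded by half of itself is zero.
      have z0 : ∫⁻ z in Ioc (k * δ) (k * δ + δ) ×ˢ univ, ‖F z - G z‖ₑ = 0 := by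
        by_contra hne
        have := key.trans (mul_le_mul_left hε _)
        have lt := ENNReal.half_lt_self hne fin
        rw [one_div, mul_comm (2⁻¹ : ℝ≥0∞), ← div_eq_mul_inv] at this
        exact absurd (this.trans_lt lt) (lt_irrefl _)
      rw [e1, ← Ioc_union_Ioc_eq_Ioc hk0 (le_add_of_nonneg_right hδ.le), union_prod]
      refine le_antisymm ((lintegral_union_le _ _ _).trans ?_) zero_le
      rw [ih, z0, add_zero]
  obtain ⟨k, hk⟩ := exists_nat_ge (T / δ)
  have hk' : T ≤ k * δ := by rwa [div_le_iff₀ hδ] at hk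
  have h0 := step k
  have hm : Measurable fun z => ‖F z - G z‖ₑ := (hFm.sub hGm).enorm
  rw [lintegral_eq_zero_iff hm, EventuallyEq,
    ae_restrict_iff' (measurableSet_Ioc.prod .univ)] at h0
  have hnull : ∀ᵐ z : ℝ × ℝ, z.1 ≠ 0 :=
    Measure.quasiMeasurePreserving_fst.ae (Measure.ae_ne volume (0 : ℝ))
  filter_upwards [h0, hnull, hFfix, hGfix] with z h1 h2 a b
  by_cases hz : z ∈ D
  · have hzT := (hDT hz).1
    have := h1 ⟨⟨lt_of_le_of_ne hzT.1 (Ne.symm h2), hzT.2.trans hk'⟩, mem_univ _⟩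
    exact sub_eq_zero.1 (enorm_eq_zero.1 this)
  · rw [a, b, picard, picard, indicator_of_notMem hz, indicator_of_notMem hz]

/-- Separates data from source: the data part is made small by a short time, the source part by the
radius of the ball, uniformly over that ball. -/
lemma lintegral_majorant_char_le {σ : ℝ} {w : ℝ → Vec n} (hwm : StronglyMeasurable w)
    (hFm : StronglyMeasurable F) (σ' : ℝ) (hσ' : σ' = 1 ∨ σ' = -1) (I : Set ℝ) (y : ℝ) :
    ∫⁻ t in I, majorant σ w F (y - 2 * σ' * t)
      ≤ (∫⁻ t in I, majorant σ w 0 (y - 2 * σ' * t)) + ∫⁻ z, ‖F z‖ₑ := by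
  have e : ∀ y, majorant σ w F y = majorant σ w 0 y + majorant σ 0 F y := fun y => by
    simp [majorant]
  simp only [e]
  have m1 := measurable_majorant (σ := σ) (F := (0 : ℝ × ℝ → Vec n)) hwm stronglyMeasurable_zero
  have m2 := measurable_majorant (σ := σ) (P := (0 : ℝ → Vec n)) stronglyMeasurable_zero hFm
  rw [lintegral_add_left (by fun_prop)]
  gcongr
  refine (lintegral_comp_char_le m2 hσ' I y).trans ?_
  rw [lintegral_majorant stronglyMeasurable_zero hFm]
  simp

/-- Banach's theorem on the closed ball of radius `r` in `L¹`. The order of choices is `r`, then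
`ε`, then the time `δ`, which depends on the data but not on `D`. -/
lemma exists_picard_fixedPoint (hΓ : ∀ j k, BoundedLipschitz (Γ j k)) (hP : BoundedLipschitz P)
    (hU : Continuous U) (hvm : StronglyMeasurable v) (hv : Integrable v)
    (hgm : StronglyMeasurable g) (hg : Integrable g) (hf : Integrable f) :
    ∃ δ : ℝ, 0 < δ ∧ ∀ T, 0 < T → T ≤ δ → ∀ D : Set (ℝ × ℝ), MeasurableSet D →
      D ⊆ Icc 0 T ×ˢ univ → ∃ F : ℝ × ℝ → Vec n, StronglyMeasurable F ∧ Integrable F ∧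
        F =ᵐ[volume] picard Γ P D U v g f F := by
  obtain ⟨M, hM₁, hM₂⟩ := exists_nullRHS_bounds hΓ hP
  have s1 : StronglyMeasurable (v + (1 : ℝ) • g) := hvm.add (hgm.const_smul (1 : ℝ))
  have s2 : StronglyMeasurable (v + (-1 : ℝ) • g) := hvm.add (hgm.const_smul (-1 : ℝ))
  have i1 : Integrable (v + (1 : ℝ) • g) := hv.add (hg.smul (1 : ℝ))
  have i2 : Integrable (v + (-1 : ℝ) • g) := hv.add (hg.smul (-1 : ℝ))
  have z0 : StronglyMeasurable (0 : ℝ × ℝ → Vec n) := stronglyMeasurable_zero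
  set N := ∫⁻ y, ‖(v + (1 : ℝ) • g) y‖ₑ with hN
  have hNt : N ≠ ⊤ := i1.2.ne
  -- In the ball the majorant of p has integral at most `N + 1`, and the transversal integrals are
  -- at most `ε + r ≤ 2r`; the contraction constant is thus at most `M (N + 1 + 3) 2r ≤ 1/2`.
  obtain ⟨r₀, hr₀, hr₀t, hr₀c⟩ := exists_mul_le_half (c := M * (N + 4) * 2)
    (ENNReal.mul_ne_top (ENNReal.mul_ne_top ENNReal.coe_ne_top
      (ENNReal.add_ne_top.2 ⟨hNt, by simp⟩)) (by simp))
  set r := min r₀ 1 with hr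
  have hr0 : r ≠ 0 := (lt_min (pos_iff_ne_zero.2 hr₀) one_pos).ne'
  have hrt : r ≠ ⊤ := ((min_le_right _ _).trans_lt ENNReal.one_lt_top).ne
  obtain ⟨ε₀, hε₀, -, hε₀c⟩ := exists_mul_le_half (c := M * (N + 1))
    (ENNReal.mul_ne_top ENNReal.coe_ne_top (ENNReal.add_ne_top.2 ⟨hNt, by simp⟩))
  -- Being proportional to `r`, it places the image of the zero source at distance at most `r / 2`
  -- from 0; with the contraction factor 1/2, the ball is mapped into itself.
  set ε := r * min ε₀ 1 with hε
  have hε0 : ε ≠ 0 := mul_ne_zero hr0 (lt_min (pos_iff_ne_zero.2 hε₀) one_pos).ne'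
  have hεr : ε ≤ r := mul_le_of_le_one_right' (min_le_right _ _)
  have hεc : M * (N + 1) * ε ≤ r / 2 := by
    calc M * (N + 1) * ε = M * (N + 1) * min ε₀ 1 * r := by rw [hε]; ring
      _ ≤ 1 / 2 * r := by gcongr; exact (mul_le_mul_right (min_le_left _ _) _).trans hε₀c
      _ = r / 2 := by rw [one_div, mul_comm, div_eq_mul_inv]
  obtain ⟨δ₁, hδ₁, h₁⟩ := exists_lintegral_char_le (measurable_majorant (σ := -1) s2 z0)
    (lintegral_majorant_ne_top s2 z0 i2 (integrable_zero _ _ _)) (Or.inl rfl) hε0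
  obtain ⟨δ₂, hδ₂, h₂⟩ := exists_lintegral_char_le (measurable_majorant (σ := 1) s1 z0)
    (lintegral_majorant_ne_top s1 z0 i1 (integrable_zero _ _ _)) (Or.inr rfl) hε0
  obtain ⟨δ₃, hδ₃, h₃⟩ := exists_lintegral_strip_le hf hε0
  refine ⟨min δ₁ (min δ₂ δ₃), lt_min hδ₁ (lt_min hδ₂ hδ₃), fun T hT0 hT D hD hDT => ?_⟩
  have l1 : T ≤ δ₁ := hT.trans (min_le_left _ _)
  have l2 : T ≤ δ₂ := hT.trans ((min_le_right _ _).trans (min_le_left _ _))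
  have l3 : T ≤ δ₃ := hT.trans ((min_le_right _ _).trans (min_le_right _ _))
  have k₁ : ∀ y, ∫⁻ t in Ioc 0 T, majorant (-1) (v + (-1 : ℝ) • g) 0 (y - 2 * 1 * t) ≤ ε :=
    fun y => (lintegral_mono_set (Ioc_subset_Ioc_right (by linarith))).trans (h₁ 0 y)
  have k₂ : ∀ y, ∫⁻ t in Ioc 0 T, majorant 1 (v + (1 : ℝ) • g) 0 (y - 2 * -1 * t) ≤ ε :=
    fun y => (lintegral_mono_set (Ioc_subset_Ioc_right (by linarith))).trans (h₂ 0 y)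
  have k₃ : ∫⁻ z in Ioc 0 T ×ˢ univ, ‖f z‖ₑ ≤ ε :=
    (lintegral_mono_set (prod_mono_left (Ioc_subset_Ioc_right (by linarith)))).trans (h₃ 0)
  have hpi : ∀ F : ℝ × ℝ → Vec n, StronglyMeasurable F → Integrable F →
      Integrable (picard Γ P D U v g f F) := fun F hFm hF =>
    integrable_picard hΓ hP hD (fun z hz => (hDT hz).1.1) hU hvm hv hgm hg hf hFm hF
  have hstrip : ∀ h : ℝ × ℝ → ℝ≥0∞, (∀ z ∉ D, h z = 0) →
      ∫⁻ z, h z = ∫⁻ z in Ioc 0 T ×ˢ univ, h z := by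
    intro h hh
    rw [← lintegral_indicator (measurableSet_Ioc.prod .univ)]
    refine lintegral_congr_ae ?_
    have hnull : ∀ᵐ z : ℝ × ℝ, z.1 ≠ 0 :=
      Measure.quasiMeasurePreserving_fst.ae (Measure.ae_ne volume (0 : ℝ))
    filter_upwards [hnull] with z hz
    by_cases hzI : z ∈ Ioc 0 T ×ˢ univ
    · rw [indicator_of_mem hzI]
    · rw [indicator_of_notMem hzI]
      refine hh z fun hzD => hzI ⟨⟨lt_of_le_of_ne (hDT hzD).1.1 (Ne.symm hz), (hDT hzD).1.2⟩,
        mem_univ _⟩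
  have hzero : ∫⁻ z, ‖picard Γ P D U v g f 0 z‖ₑ ≤ r / 2 := by
    rw [hstrip _ fun z hz => by rw [picard, indicator_of_notMem hz, enorm_zero]]
    refine (lintegral_picard_le hM₁ hvm hgm z0 k₁).trans (le_trans ?_ hεc)
    rw [lintegral_majorant s1 z0, ← hN]
    calc _ ≤ M * (ε * (N + 0) + ε) := by gcongr; simp
      _ = _ := by ring
  have hcontr : ∀ F G : ℝ × ℝ → Vec n, StronglyMeasurable F → Integrable F →
      StronglyMeasurable G → Integrable G → ∫⁻ z, ‖F z‖ₑ ≤ r → ∫⁻ z, ‖G z‖ₑ ≤ r →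
      ∫⁻ z, ‖picard Γ P D U v g f F z - picard Γ P D U v g f G z‖ₑ
        ≤ 1 / 2 * ∫⁻ z, ‖F z - G z‖ₑ := by
    intro F G hFm hF hGm hG hFr hGr
    rw [hstrip _ fun z hz => by
      rw [picard, picard, indicator_of_notMem hz, indicator_of_notMem hz, sub_zero, enorm_zero]]
    refine (lintegral_picard_sub_le (ε := 2 * r) hM₂ hvm hgm hFm hF hGm hG le_rfl hT0.le (by simp)
      (fun y => ?_) (fun y => ?_) ?_).trans ?_
    · refine (lintegral_majorant_char_le s2 hFm 1 (Or.inl rfl) _ y).trans ?_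
      rw [two_mul r]
      exact add_le_add ((k₁ y).trans hεr) hFr
    · refine (lintegral_majorant_char_le s1 hGm (-1) (Or.inr rfl) _ y).trans ?_
      rw [two_mul r]
      exact add_le_add ((k₂ y).trans hεr) hGr
    · rw [two_mul r]
      exact k₃.trans (hεr.trans le_self_add)
    · refine mul_le_mul' ?_ (setLIntegral_le_lintegral _ _)
      rw [lintegral_majorant s1 hFm, ← hN]
      calc _ ≤ M * (N + 1 + 3) * (2 * r₀) := by
            gcongr
            · exact hFr.trans (min_le_right _ _)
            · exact min_le_left _ _
        _ = M * (N + 4) * 2 * r₀ := by rw [add_assoc]; norm_num; ring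
        _ ≤ _ := hr₀c
  let Ψ : Lp (Vec n) 1 (volume : Measure (ℝ × ℝ)) → Lp (Vec n) 1 (volume : Measure (ℝ × ℝ)) :=
    fun F => (hpi F (Lp.stronglyMeasurable F) (L1.integrable_coeFn F)).toL1 _
  have hΨ : ∀ F, Ψ F =ᵐ[volume] picard Γ P D U v g f F := fun F => Integrable.coeFn_toL1 _
  set S : Set (Lp (Vec n) 1 (volume : Measure (ℝ × ℝ))) := {F | edist F 0 ≤ r} with hS
  have hSc : IsComplete S :=
    (isClosed_le (by fun_prop) continuous_const).isComplete
  have hnorm : ∀ F : Lp (Vec n) 1 (volume : Measure (ℝ × ℝ)), edist F 0 = ∫⁻ z, ‖F z‖ₑ := by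
    intro F
    rw [edist_zero_right, Lp.enorm_def, eLpNorm_one_eq_lintegral_enorm]
  have hdist : ∀ F G : Lp (Vec n) 1 (volume : Measure (ℝ × ℝ)),
      edist F G = ∫⁻ z, ‖F z - G z‖ₑ := by
    intro F G
    rw [Lp.edist_def, eLpNorm_one_eq_lintegral_enorm]
    rfl
  have hΨd : ∀ F ∈ S, ∀ G ∈ S, edist (Ψ F) (Ψ G) ≤ 1 / 2 * edist F G := by
    intro F hFS G hGS
    rw [hdist, hdist]
    have e : ∫⁻ z, ‖Ψ F z - Ψ G z‖ₑ
        = ∫⁻ z, ‖picard Γ P D U v g f F z - picard Γ P D U v g f G z‖ₑ := by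
      refine lintegral_congr_ae ?_
      filter_upwards [hΨ F, hΨ G] with z a b
      rw [a, b]
    rw [e]
    exact hcontr F G (Lp.stronglyMeasurable F) (L1.integrable_coeFn F) (Lp.stronglyMeasurable G)
      (L1.integrable_coeFn G) (hnorm F ▸ hFS) (hnorm G ▸ hGS)
  have h0S : (0 : Lp (Vec n) 1 (volume : Measure (ℝ × ℝ))) ∈ S := by simp [hS]
  have hΨ0 : edist (Ψ 0) 0 ≤ r / 2 := by
    have hz : ∫⁻ z, ‖(0 : Lp (Vec n) 1 (volume : Measure (ℝ × ℝ))) z‖ₑ = 0 := by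
      rw [← hnorm, edist_self]
    -- The chosen representative of the zero class is only almost everywhere zero, so its Picard
    -- image is compared with that of the zero function through the contraction estimate.
    have key := hcontr _ 0 (Lp.stronglyMeasurable 0) (L1.integrable_coeFn 0) z0
      (integrable_zero _ _ _) (hz.trans_le zero_le) (by simp)
    simp only [Pi.zero_apply, sub_zero, hz, mul_zero] at key
    have m0 := (hpi 0 z0 (integrable_zero _ _ _)).1.enorm
    calc edist (Ψ 0) 0 = ∫⁻ z, ‖picard Γ P D U v g f (0 : Lp (Vec n) 1 volume) z‖ₑ := by
          rw [hnorm]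
          exact lintegral_congr_ae ((hΨ 0).mono fun z hz => congrArg enorm hz)
      _ ≤ ∫⁻ z, (‖picard Γ P D U v g f (0 : Lp (Vec n) 1 volume) z - picard Γ P D U v g f 0 z‖ₑ
            + ‖picard Γ P D U v g f 0 z‖ₑ) := lintegral_mono fun z => by
          simpa using enorm_add_le (picard Γ P D U v g f (0 : Lp (Vec n) 1 volume) z
            - picard Γ P D U v g f 0 z) (picard Γ P D U v g f 0 z)
      _ ≤ 0 + r / 2 := by
          rw [lintegral_add_right' _ m0]
          exact add_le_add key hzero
      _ = r / 2 := zero_add _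
  have hmaps : MapsTo Ψ S S := by
    intro F hFS
    calc edist (Ψ F) 0 ≤ edist (Ψ F) (Ψ 0) + edist (Ψ 0) 0 := edist_triangle _ _ _
      _ ≤ 1 / 2 * r + r / 2 := by
          refine add_le_add ((hΨd F hFS 0 h0S).trans ?_) hΨ0
          gcongr
          exact hFS
      _ = r := by rw [one_div, mul_comm, ← div_eq_mul_inv, ENNReal.add_halves]
  have hc : ContractingWith (1 / 2 : ℝ≥0) (hmaps.restrict Ψ S S) := by
    refine ⟨by norm_num, fun F G => ?_⟩
    have := hΨd F F.2 G G.2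
    simpa [Subtype.edist_eq] using this
  obtain ⟨F, -, hFix, -⟩ := hc.exists_fixedPoint' hSc hmaps h0S
    (by rw [edist_comm]; exact (hΨ0.trans_lt (ENNReal.div_lt_top hrt (by simp))).ne)
  refine ⟨F, Lp.stronglyMeasurable F, L1.integrable_coeFn F, ?_⟩
  have := hΨ F
  rwa [hFix] at this

end FixedPoint

/-! ### Extension of the initial position to the line. -/

section InitialData

variable {n : ℕ}

lemma absolutelyContinuousOnInterval_apply {u : ℝ → Vec n} {c d : ℝ}
    (h : AbsolutelyContinuousOnInterval u c d) (i : Fin n) :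
    AbsolutelyContinuousOnInterval (fun x => u x i) c d := by
  rw [absolutelyContinuousOnInterval_iff] at h ⊢
  intro ε hε
  obtain ⟨δ, hδ, H⟩ := h ε hε
  refine ⟨δ, hδ, fun I hI hIδ => lt_of_le_of_lt ?_ (H I hI hIδ)⟩
  exact Finset.sum_le_sum fun k _ => dist_le_pi_dist _ _ i

lemma integral_deriv_eq_sub_of_absolutelyContinuous {u : ℝ → Vec n} {c d : ℝ}
    (h : AbsolutelyContinuousOnInterval u c d) (hi : IntervalIntegrable (deriv u) volume c d) :
    ∫ x in c..d, deriv u x = u d - u c := by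
  ext i
  have hAC := fun i => absolutelyContinuousOnInterval_apply h i
  have e1 : (∫ x in c..d, deriv u x) i = ∫ x in c..d, deriv u x i :=
    ((ContinuousLinearMap.proj (R := ℝ) (φ := fun _ : Fin n => ℝ) i).intervalIntegral_comp_comm
      hi).symm
  rw [e1, Pi.sub_apply, ← (hAC i).integral_deriv_eq_sub]
  refine intervalIntegral.integral_congr_ae ?_
  -- Where all components are differentiable, so is `u`, and its derivative is computed
  -- componentwise.
  filter_upwards [ae_all_iff.2 fun i => (hAC i).ae_differentiableAt] with x hx hxI
  have hd : HasDerivAt u (fun i => deriv (fun y => u y i) x) x :=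
    hasDerivAt_pi.2 fun i => (hx i (uIoc_subset_uIcc hxI)).hasDerivAt
  rw [hd.deriv]

/-- The initial position extends to a continuous function on `ℝ` with integrable derivative. -/
lemma MemLinftyW11.exists_extension {a b : ℝ} {u₀ : ℝ → Vec n} (hab : a < b)
    (h : MemLinftyW11 a b u₀) : ∃ U g : ℝ → Vec n, StronglyMeasurable g ∧ Integrable g ∧
      Continuous U ∧ (∀ x y, U x = U y + ∫ z in y..x, g z) ∧ EqOn U u₀ (Icc a b) := by
  set g := (Ioo a b).indicator (deriv u₀) with hg
  have hgi : Integrable g := (integrable_indicator_iff measurableSet_Ioo).2 h.integrable_deriv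
  set U : ℝ → Vec n := fun x => u₀ a + ∫ z in a..x, g z with hU
  have hUc : Continuous U := continuous_const.add
    (intervalIntegral.continuous_primitive (fun _ _ => hgi.intervalIntegrable) a)
  have hUg : ∀ x y, U x = U y + ∫ z in y..x, g z := fun x y => by
    rw [hU]
    dsimp only
    rw [add_assoc, intervalIntegral.integral_add_adjacent_intervals hgi.intervalIntegrable
      hgi.intervalIntegrable]
  refine ⟨U, g, (stronglyMeasurable_deriv u₀).indicator measurableSet_Ioo, hgi, hUc, hUg, ?_⟩
  set m := (a + b) / 2
  have hm : m ∈ Ioo a b := ⟨by simp only [m]; linarith, by simp only [m]; linarith⟩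
  -- Absolute continuity is available only inside the open interval, so integration starts at the
  -- midpoint. Continuity extends the identity to the endpoints, and the constant vanishes on
  -- evaluation at `a`.
  have hIoo : EqOn U (fun x => u₀ x + (U m - u₀ m)) (Ioo a b) := by
    intro x hx
    have hsub : uIcc m x ⊆ Ioo a b := ordConnected_Ioo.uIcc_subset hm hx
    have hii : IntervalIntegrable (deriv u₀) volume m x :=
      intervalIntegrable_iff.2 (h.integrable_deriv.mono_set (uIoc_subset_uIcc.trans hsub))
    have e := integral_deriv_eq_sub_of_absolutelyContinuous (h.locallyAC m x hsub) hii
    have e2 : ∫ z in m..x, g z = ∫ z in m..x, deriv u₀ z :=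
      intervalIntegral.integral_congr fun z hz => indicator_of_mem (hsub hz) _
    change U x = u₀ x + (U m - u₀ m)
    rw [hUg x m, e2, e]
    abel
  have hIcc := hIoo.of_subset_closure hUc.continuousOn (h.continuousOn.add continuousOn_const)
    Ioo_subset_Icc_self (closure_Ioo hab.ne).ge
  have ha := hIcc (left_mem_Icc.2 hab.le)
  have hUa : U a = u₀ a := by simp [hU]
  have hc : U m - u₀ m = 0 := by
    dsimp only at ha
    rw [hUa] at ha
    exact left_eq_add.1 ha
  intro x hx
  have := hIcc hx
  dsimp only at this
  rwa [hc, add_zero] at this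

end InitialData

/-! ### Correspondence between mild solutions and fixed points. -/

section MildSolutions

variable {n : ℕ}

lemma convex_backwardTriangle (t x : ℝ) : Convex ℝ (backwardTriangle t x) := by
  rintro p ⟨⟨p1, p2⟩, p3, p4⟩ q ⟨⟨q1, q2⟩, q3, q4⟩ a b ha hb hab
  obtain rfl : b = 1 - a := by linarith
  simp only [backwardTriangle, mem_ofPred_eq, mem_Icc, Prod.fst_add, Prod.snd_add, Prod.smul_fst,
    Prod.smul_snd, smul_eq_mul]
  refine ⟨⟨by positivity, ?_⟩, ?_, ?_⟩ <;> nlinarith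

lemma backwardTriangle_subset_of_mem {t x : ℝ} {z : ℝ × ℝ} (hz : z ∈ backwardTriangle t x) :
    backwardTriangle z.1 z.2 ⊆ backwardTriangle t x := by
  obtain ⟨⟨h1, h2⟩, h3, h4⟩ := hz
  rintro q ⟨⟨q1, q2⟩, q3, q4⟩
  exact ⟨⟨q1, by linarith⟩, by linarith, by linarith⟩

lemma backwardTriangle_subset_compactTrapezoid {x₀ L T t x : ℝ}
    (h : (t, x) ∈ compactTrapezoid x₀ L T) : backwardTriangle t x ⊆ compactTrapezoid x₀ L T := by
  obtain ⟨⟨h1, h2⟩, h3, h4⟩ := h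
  rintro q ⟨⟨q1, q2⟩, q3, q4⟩
  dsimp only at *
  exact ⟨⟨q1, by linarith⟩, by linarith, by linarith⟩

lemma compactTrapezoid_mono {x₀ L T T' : ℝ} (h : T ≤ T') :
    compactTrapezoid x₀ L T ⊆ compactTrapezoid x₀ L T' :=
  fun _ hz => ⟨⟨hz.1.1, hz.1.2.trans h⟩, hz.2⟩

lemma freeWave_eq_of_mem {x₀ L T : ℝ} {U v u₀ v₀ : ℝ → Vec n}
    (hU : EqOn U u₀ (Icc (x₀ - L) (x₀ + L))) (hv : v =ᵐ[volume] (Icc (x₀ - L) (x₀ + L)).indicator v₀)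
    {t x : ℝ} (h : (t, x) ∈ compactTrapezoid x₀ L T) :
    freeWave U v (t, x) = (1 / 2 : ℝ) • (u₀ (x + t) + u₀ (x - t))
      + (1 / 2 : ℝ) • ∫ y in (x - t)..(x + t), v₀ y := by
  obtain ⟨⟨h1, h2⟩, h3, h4⟩ := h
  dsimp only at *
  simp only [freeWave]
  rw [hU ⟨by linarith, by linarith⟩, hU ⟨by linarith, by linarith⟩]
  congr 2
  refine intervalIntegral.integral_congr_ae ?_
  filter_upwards [hv] with y hy hyI
  rw [uIoc_of_le (by linarith)] at hyI
  rw [hy, indicator_of_mem]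
  exact ⟨by linarith [hyI.1], by linarith [hyI.2]⟩

variable {Γ : Fin n → Fin n → Vec n → Vec n} {P : Vec n → Vec n →L[ℝ] Vec n}
  {U v g u₀ v₀ : ℝ → Vec n} {f : ℝ × ℝ → Vec n} {x₀ L T : ℝ}

/-- On each backward triangle a mild solution is given by a fixed point of `picard`. -/
lemma IsMildSolution.exists_fixedPoint (hTL : T ≤ L) {w : ℝ × ℝ → Vec n}
    (hvm : StronglyMeasurable v) (hv : Integrable v)
    (hgm : StronglyMeasurable g) (hg : Integrable g) (hUc : Continuous U)
    (hU : ∀ x y, U x = U y + ∫ z in y..x, g z) (hUu : EqOn U u₀ (Icc (x₀ - L) (x₀ + L)))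
    (hvv : v =ᵐ[volume] (Icc (x₀ - L) (x₀ + L)).indicator v₀)
    (hw : IsMildSolution Γ P (compactTrapezoid x₀ L T) u₀ v₀ f w) {t x : ℝ}
    (htx : (t, x) ∈ compactTrapezoid x₀ L T) :
    ∃ F : ℝ × ℝ → Vec n, StronglyMeasurable F ∧ Integrable F ∧
      F =ᵐ[volume] picard Γ P (backwardTriangle t x) U v g
        ((compactTrapezoid x₀ L L).indicator f) F ∧ w (t, x) = wave U v F (t, x) := by
  obtain ⟨-, wt, wx, hwt, hwx, -, -, hw⟩ := hw
  set Δ := backwardTriangle t x with hΔ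
  have hΔm : MeasurableSet Δ := (isClosed_backwardTriangle t x).measurableSet
  have hΔK : Δ ⊆ compactTrapezoid x₀ L T := backwardTriangle_subset_compactTrapezoid htx
  set R := forcedRHS Γ P w wt wx f with hR
  have hRi : Integrable (Δ.indicator R) := (integrable_indicator_iff hΔm).2 (hw t x htx).1
  set F := hRi.1.mk with hF
  have hFR : Δ.indicator R =ᵐ[volume] F := hRi.1.ae_eq_mk
  have hFm : StronglyMeasurable F := hRi.1.stronglyMeasurable_mk
  have hFi : Integrable F := hRi.congr hFR
  -- The integral equation is used at every point of the triangle: the backward triangle of such a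
  -- point stays inside `Δ`, where `F` represents the right-hand side.
  have hwave : EqOn w (wave U v F) Δ := by
    intro z hz
    have hzK := hΔK hz
    obtain ⟨hi, he⟩ := hw z.1 z.2 hzK
    have hcongr : R =ᵐ[volume.restrict (backwardTriangle z.1 z.2)] F := by
      rw [EventuallyEq, ae_restrict_iff' (isClosed_backwardTriangle _ _).measurableSet]
      filter_upwards [hFR] with q hq hqz
      rw [← hq, indicator_of_mem (backwardTriangle_subset_of_mem hz hqz)]
    rw [wave, ← duhamel_congr hz.1.1 hi hcongr, freeWave_eq_of_mem hUu hvv hzK]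
    exact he
  refine ⟨F, hFm, hFi, ?_, hwave ⟨⟨htx.1.1, le_rfl⟩, by simp, by simp⟩⟩
  have hpos : ∀ z ∈ interior Δ, 0 < z.1 := fun z hz =>
    pos_of_mem_interior (K := Δ) (fun q hq => hq.1.1) hz
  obtain ⟨d1, d2⟩ := hasWeakDerivOn_wave isOpen_interior hpos hFm hFi hvm hv hgm hg hUc hU
  have hsub : interior Δ ⊆ interior (compactTrapezoid x₀ L T) := interior_mono hΔK
  have heq : EqOn w (wave U v F) (interior Δ) := hwave.mono interior_subset
  -- By uniqueness of weak derivatives, those of `w` are the characteristic combinations on the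
  -- interior of `Δ`. The boundary is null because `Δ` is convex.
  have a1 := (hwt.mono isOpen_interior.measurableSet hsub).ae_eq isOpen_interior d1 heq
  have a2 := (hwx.mono isOpen_interior.measurableSet hsub).ae_eq isOpen_interior d2 heq
  rw [EventuallyEq, ae_restrict_iff' isOpen_interior.measurableSet] at a1 a2
  have hfr : ∀ᵐ z : ℝ × ℝ, z ∉ frontier Δ :=
    compl_mem_ae_iff.2 ((convex_backwardTriangle t x).addHaar_frontier volume)
  filter_upwards [hFR, a1, a2, hfr] with z b0 b1 b2 b3
  rw [← b0, picard]
  by_cases hz : z ∈ Δ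
  · have hzi : z ∈ interior Δ := by
      by_contra hc
      exact b3 ⟨subset_closure hz, hc⟩
    rw [indicator_of_mem hz, indicator_of_mem hz, hR, forcedRHS_eq_nullRHS (b1 hzi) (b2 hzi),
      hwave hz, indicator_of_mem (compactTrapezoid_mono hTL (hΔK hz))]
  · rw [indicator_of_notMem hz, indicator_of_notMem hz]

/-- A fixed point of `picard` on a trapezoid yields a mild solution. -/
lemma isMildSolution_wave (hTL : T ≤ L) {F : ℝ × ℝ → Vec n}
    (hvm : StronglyMeasurable v) (hv : Integrable v)
    (hgm : StronglyMeasurable g) (hg : Integrable g) (hUc : Continuous U)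
    (hU : ∀ x y, U x = U y + ∫ z in y..x, g z) (hUu : EqOn U u₀ (Icc (x₀ - L) (x₀ + L)))
    (hvv : v =ᵐ[volume] (Icc (x₀ - L) (x₀ + L)).indicator v₀)
    (hFm : StronglyMeasurable F) (hF : Integrable F)
    (hfix : F =ᵐ[volume] picard Γ P (compactTrapezoid x₀ L T) U v g
        ((compactTrapezoid x₀ L L).indicator f) F) :
    MemH (compactTrapezoid x₀ L T) T (wave U v F) ∧
      IsMildSolution Γ P (compactTrapezoid x₀ L T) u₀ v₀ f (wave U v F) := by
  set K := compactTrapezoid x₀ L T with hK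
  have hK0 : ∀ z ∈ K, 0 ≤ z.1 := fun z hz => hz.1.1
  have hKs : K ⊆ Icc 0 T ×ˢ univ := fun z hz => ⟨hz.1, mem_univ _⟩
  have s1 : StronglyMeasurable (v + (1 : ℝ) • g) := hvm.add (hgm.const_smul (1 : ℝ))
  have s2 : StronglyMeasurable (v + (-1 : ℝ) • g) := hvm.add (hgm.const_smul (-1 : ℝ))
  have i1 : Integrable (v + (1 : ℝ) • g) := hv.add (hg.smul (1 : ℝ))
  have i2 : Integrable (v + (-1 : ℝ) • g) := hv.add (hg.smul (-1 : ℝ))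
  have hc : ContinuousOn (wave U v F) K := (continuousOn_wave hUc hv hF).mono hK0
  obtain ⟨d1, d2⟩ := hasWeakDerivOn_wave (Ω := interior K) isOpen_interior
    (fun z hz => pos_of_mem_interior hK0 hz) hFm hF hvm hv hgm hg hUc hU
  have j1 : IntegrableOn (charDeriv 1 (v + (1 : ℝ) • g) F) K :=
    (integrableOn_charDeriv s1 hFm i1 hF T).mono_set hKs
  have j2 : IntegrableOn (charDeriv (-1) (v + (-1 : ℝ) • g) F) K :=
    (integrableOn_charDeriv s2 hFm i2 hF T).mono_set hKs
  have it : IntegrableOn (fun z => (1 / 2 : ℝ) • charDeriv 1 (v + (1 : ℝ) • g) F z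
      + (1 / 2 : ℝ) • charDeriv (-1) (v + (-1 : ℝ) • g) F z) K := (j1.smul (1 / 2 : ℝ)).add (j2.smul (1 / 2 : ℝ))
  have ix : IntegrableOn (fun z => (1 / 2 : ℝ) • charDeriv 1 (v + (1 : ℝ) • g) F z
      + (-(1 / 2) : ℝ) • charDeriv (-1) (v + (-1 : ℝ) • g) F z) K := (j1.smul (1 / 2 : ℝ)).add (j2.smul (-(1 / 2) : ℝ))
  have c1 := memCL1_charDeriv (σ := 1) s1 hFm i1 hF x₀ L T
  have c2 := memCL1_charDeriv (σ := -1) s2 hFm i2 hF x₀ L T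
  refine ⟨⟨hc, _, _, d1, d2, it.mono_set interior_subset, ix.mono_set interior_subset,
    c1.lincomb c2 _ _, c1.lincomb c2 _ _⟩, hc, _, _, d1, d2, it.locallyIntegrableOn,
    ix.locallyIntegrableOn, fun t x htx => ?_⟩
  have hΔK : backwardTriangle t x ⊆ K := backwardTriangle_subset_compactTrapezoid htx
  set R := forcedRHS Γ P (wave U v F) (fun z => (1 / 2 : ℝ) • charDeriv 1 (v + (1 : ℝ) • g) F z
        + (1 / 2 : ℝ) • charDeriv (-1) (v + (-1 : ℝ) • g) F z)
      (fun z => (1 / 2 : ℝ) • charDeriv 1 (v + (1 : ℝ) • g) F z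
        + (-(1 / 2) : ℝ) • charDeriv (-1) (v + (-1 : ℝ) • g) F z) f with hR
  -- Inside the trapezoid both cut-offs, that of `picard` and that of `f`, are invisible, so the
  -- fixed-point equation is the original one.
  have hFR : F =ᵐ[volume.restrict (backwardTriangle t x)] R := by
    rw [EventuallyEq, ae_restrict_iff' (isClosed_backwardTriangle _ _).measurableSet]
    filter_upwards [hfix] with z hz hzΔ
    rw [hz, picard, indicator_of_mem (hΔK hzΔ), hR, forcedRHS_eq_nullRHS rfl rfl,
      indicator_of_mem (compactTrapezoid_mono hTL (hΔK hzΔ))]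
  refine ⟨hF.integrableOn.congr hFR, ?_⟩
  have e := duhamel_congr (z := (t, x)) htx.1.1 hF.integrableOn hFR
  rw [wave, e, freeWave_eq_of_mem hUu hvv htx]
  rfl

end MildSolutions

end ForcedWaveMap

/-! ### Local existence and uniqueness. -/

theorem mainTheorem8 {n : ℕ}
    (Γ : Fin n → Fin n → ForcedWaveMap.Vec n → ForcedWaveMap.Vec n)
    (P : ForcedWaveMap.Vec n → ForcedWaveMap.Vec n →L[ℝ] ForcedWaveMap.Vec n)
    (hΓ : ∀ j k, ForcedWaveMap.BoundedLipschitz (Γ j k))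
    (hP : ForcedWaveMap.BoundedLipschitz P)
    (x₀ L : ℝ) (hL : 0 < L)
    (u₀ v₀ : ℝ → ForcedWaveMap.Vec n) (f : ℝ × ℝ → ForcedWaveMap.Vec n)
    (hdata : ForcedWaveMap.MemL11 (x₀ - L) (x₀ + L) u₀ v₀)
    (hf : IntegrableOn f (ForcedWaveMap.compactTrapezoid x₀ L L)) :
    ∃ T₀ : ℝ, 0 < T₀ ∧ T₀ ≤ L ∧
      ∃ u : ℝ × ℝ → ForcedWaveMap.Vec n,
        (ForcedWaveMap.MemH (ForcedWaveMap.compactTrapezoid x₀ L T₀) T₀ u ∧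
          ForcedWaveMap.IsMildSolution Γ P (ForcedWaveMap.compactTrapezoid x₀ L T₀) u₀ v₀ f u) ∧
        ∀ w : ℝ × ℝ → ForcedWaveMap.Vec n,
          ForcedWaveMap.MemH (ForcedWaveMap.compactTrapezoid x₀ L T₀) T₀ w →
          ForcedWaveMap.IsMildSolution Γ P (ForcedWaveMap.compactTrapezoid x₀ L T₀) u₀ v₀ f w →
          EqOn w u (ForcedWaveMap.compactTrapezoid x₀ L T₀) := by
  open ForcedWaveMap in
  obtain ⟨U, g, hgm, hg, hUc, hU, hUu⟩ := hdata.position.exists_extension (by linarith)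
  have hv₀ := (integrable_indicator_iff measurableSet_Icc).2 hdata.velocity
  have hvm := hv₀.1.stronglyMeasurable_mk
  have hvv := hv₀.1.ae_eq_mk.symm
  have hv := hv₀.congr hvv.symm
  set v := hv₀.1.mk
  have hfi := (integrable_indicator_iff
    (isClosed_compactTrapezoid x₀ L L).measurableSet).2 hf
  obtain ⟨δ, hδ, hex⟩ := exists_picard_fixedPoint hΓ hP hUc hvm hv hgm hg hfi
  have hT : 0 < min δ L := lt_min hδ hL
  obtain ⟨F, hFm, hF, hfix⟩ := hex (min δ L) hT (min_le_left _ _)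
    (compactTrapezoid x₀ L (min δ L)) (isClosed_compactTrapezoid _ _ _).measurableSet
    fun z hz => ⟨hz.1, mem_univ _⟩
  have hsol := isMildSolution_wave (min_le_right δ L) hvm hv hgm hg hUc hU hUu hvv hFm hF hfix
  refine ⟨min δ L, hT, min_le_right _ _, wave U v F, hsol, ?_⟩
  rintro w - hw ⟨t, x⟩ htx
  -- Both solutions are compared on the backward triangle of one point, the region on which the
  -- right-hand side is assumed integrable. Each gives a fixed point of the same `picard` map there.
  obtain ⟨G₁, m₁, i₁, fix₁, e₁⟩ :=
    hw.exists_fixedPoint (min_le_right _ _) hvm hv hgm hg hUc hU hUu hvv htx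
  obtain ⟨G₂, m₂, i₂, fix₂, e₂⟩ :=
    hsol.2.exists_fixedPoint (min_le_right _ _) hvm hv hgm hg hUc hU hUu hvv htx
  have hG := picard_fixedPoint_unique hΓ hP (T := t) (fun z hz => ⟨hz.1, mem_univ _⟩)
    hvm hv hgm hg hfi m₁ i₁ m₂ i₂ fix₁ fix₂
  rw [e₁, e₂, wave, wave, duhamel_congr htx.1.1 i₁.integrableOn (ae_restrict_of_ae hG)]
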